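/- Let $s\ge 13$, and let $a_j,b_j$ $(1\le j\le s)$ be integers with $(a_j,b_j)\ne(0,0)$ for every $j$. Suppose that for every pair $(c,d)\in\mathbb Z^2\setminus\{(0,0)\}$ at least $s-6$ of the numbers $ca_j+db_j$ $(1\le j\le s)$ are non-zero. Consider the system $$\sum_{j=1}^s a_jx_j^3=\sum_{j=1}^s b_jx_j^3=0.\qquad(\ast)$$ Write $e(z)=e^{2\pi i z}$, $S(q,r)=\sum_{\ell=1}^q e(r\ell^3/q)$, $U(q,c,d)=q^{-s}\prod_{j=1}^s S(q,a_jc+b_jd)$, $$A(q)=\sum_{\substack{1\le c,d\le q\\ (c,d,q)=1}}U(q,c,d),\qquad \mathfrak S(X)=\sum_{1\le q\le X}A(q),$$ and, for a prime $p$, let $\chi_p=\lim_{h\to\infty}p^{h(2-s)}M_s(p^h)$, where $M_s(p^h)$ is the number of solutions of $(\ast)$ with $\mathbf x\in(\mathbb Z/p^h\mathbb Z)^s$. Then the following hold, all implicit constants depending at most on $s$ and the coefficients $a_j,b_j$. (i) The limit $\mathfrak S=\lim_{X\to\infty}\mathfrak S(X)$ exists and is a real number, and $\mathfrak S-\mathfrak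 S(X)\ll X^{-1/4}$ for $X>0$. (ii) For every prime $p$ the limit $\chi_p$ exists; the Euler product $\prod_p\chi_p$ converges absolutely, that is, $\sum_p|\chi_p-1|<\infty$, and its value is $\mathfrak S$. (iii) For every prime $p$ one has $\chi_p=0$ if and only if $(\ast)$ has no non-trivial solution in $\mathbb Q_p$. (iv) If $(\ast)$ has a non-trivial solution in $\mathbb Q_p$ for every prime $p$, then $\mathfrak S\gg1$, that is, $\mathfrak S$ is bounded below by a positive constant. -/

import Mathlib

open Filter Topology

noncomputable section

namespace CubicPair

/-- `x` solves the pair of diagonal cubic equations `∑ a_j x_j ^ 3 = ∑ b_j x_j ^ 3 = 0`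
over the commutative ring `R`. -/
def IsSolution {s : ℕ} (a b : Fin s → ℤ) {R : Type*} [CommRing R] (x : Fin s → R) : Prop :=
  ∑ j, (a j : R) * x j ^ 3 = 0 ∧ ∑ j, (b j : R) * x j ^ 3 = 0

/-- The pair of equations has a non-trivial solution over `R`. -/
def HasNontrivialSolution {s : ℕ} (a b : Fin s → ℤ) (R : Type*) [CommRing R] : Prop :=
  ∃ x : Fin s → R, x ≠ 0 ∧ IsSolution a b x

/-- The pair of equations has a non-trivial solution over the field `ℚ_p` of `p`-adic numbers. -/
def HasNontrivialPadicSolution {s : ℕ} (a b : Fin s → ℤ) (p : Nat.Primes) : Prop :=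
  haveI : Fact (p : ℕ).Prime := ⟨p.2⟩
  HasNontrivialSolution a b ℚ_[(p : ℕ)]

/-- `M_s(n)`: the number of solutions of the pair of equations in `(ℤ / nℤ) ^ s`. -/
def solutionCount {s : ℕ} (a b : Fin s → ℤ) (n : ℕ) : ℕ :=
  Nat.card {x : Fin s → ZMod n // IsSolution a b x}

/-- The normalised count `p ^ (h (2 - s)) * M_s(p ^ h)`; its limit as `h → ∞` is the
`p`-adic density. -/
def normalizedCount {s : ℕ} (a b : Fin s → ℤ) (p h : ℕ) : ℝ :=
  (p : ℝ) ^ ((h : ℤ) * (2 - (s : ℤ))) * (solutionCount a b (p ^ h) : ℝ)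

/-- The cubic Gauss sum `S(q, r) = ∑_{1 ≤ ℓ ≤ q} e(r ℓ ^ 3 / q)`, `e(z) = exp(2πiz)`. -/
def cubicGaussSum (q : ℕ) (r : ℤ) : ℂ :=
  ∑ l ∈ Finset.Icc 1 q,
    Complex.exp (2 * (Real.pi : ℂ) * Complex.I * ((r : ℂ) * (l : ℂ) ^ 3 / (q : ℂ)))

/-- `U(q, c, d) = q ^ (-s) ∏_j S(q, a_j c + b_j d)`. -/
def U {s : ℕ} (a b : Fin s → ℤ) (q : ℕ) (c d : ℤ) : ℂ :=
  ((q : ℂ) ^ s)⁻¹ * ∏ j, cubicGaussSum q (a j * c + b j * d)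

/-- `A(q)`: the sum of `U(q, c, d)` over `1 ≤ c, d ≤ q` with `(c, d, q) = 1`. -/
def A {s : ℕ} (a b : Fin s → ℤ) (q : ℕ) : ℂ :=
  ∑ c ∈ Finset.Icc 1 q, ∑ d ∈ Finset.Icc 1 q,
    if Nat.gcd (Nat.gcd c d) q = 1 then U a b q (c : ℤ) (d : ℤ) else 0

/-- The truncated singular series `𝔖(X) = ∑_{1 ≤ q ≤ X} A(q)`. -/
def truncatedSingularSeries {s : ℕ} (a b : Fin s → ℤ) (X : ℝ) : ℂ :=
  ∑ q ∈ Finset.Icc 1 ⌊X⌋₊, A a b q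

end CubicPair

end

namespace CubicPair

/-! ### Gauss sums -/

/-! The singular series is a Möbius transform of solution counts. Sorting the pairs (c, d) modulo q
by their common divisor with q, and using orthogonality of additive characters, gives ∑_{m ∣ q} A(m)
= q^(2-s) M_s(q) (`sum_divisors_A`). As M_s is multiplicative by the Chinese remainder theorem, A is
real and multiplicative (`A_eq_seriesFun`), and the normalised counts modulo p^h are the partial
sums of ∑ A(p^k). Parts (i) and (ii) thus reduce to one absolute convergence statement, ∑ |A(n)|
n^(1/4) < ∞ (`summable_weighted`).

For that, let q = p^h. Elementary arguments give |S(q, r)|^3 ≤ 64 q^2 (q, r)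
(`norm_cubicGaussSum_prime_pow_le`). If (c, d, q) = 1, let g be the largest of the gcds of q with
the s linear forms. Any other of these gcds divides g, hence divides a 2 × 2 minor, and is bounded
unless its column is proportional to the one giving g, which happens for at most six columns. So the
product of the gcds is O(g^6) (`prod_gcd_le`) and U = O(q^(-13/3) g^2). The sum of g^2 over c, d is
O((h+1) q^3), whence A(q) = O((h+1) q^(-4/3)), with room for the weight n^(1/4).

For (iii), if there is no p-adic solution, compactness forces all solutions modulo a high power of p
to be divisible by p. Removing this factor shrinks the normalised count by p^(6-s) whenever the
exponent drops by three, so the density is 0 (`localDensity_eq_zero`). Conversely, a nontrivial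
p-adic solution can be made nonsingular, because diagonal cubic forms in seven variables over ℚ_p
are isotropic (`isotropicOn_of_seven_le`); near a nonsingular solution s - 2 coordinates are free,
so the density is positive (`localDensity_pos`). For (iv), an absolutely convergent product of
positive factors is the exponential of a convergent sum (`singularSeries_pos`). -/

lemma sum_range_natCast {M : Type*} [AddCommMonoid M] (q : ℕ) [NeZero q] (f : ZMod q → M) :
    ∑ l ∈ Finset.range q, f (l : ZMod q) = ∑ x, f x := by
  refine Finset.sum_nbij' (fun l => (l : ZMod q)) ZMod.val ?_ ?_ ?_ ?_ ?_
  · simp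
  · intro x _
    simpa using ZMod.val_lt x
  · intro l hl
    exact ZMod.val_cast_of_lt (by simpa using hl)
  · simp
  · simp

lemma sum_Icc_natCast {M : Type*} [AddCommMonoid M] (q : ℕ) [NeZero q] (f : ZMod q → M) :
    ∑ l ∈ Finset.Icc 1 q, f (l : ZMod q) = ∑ x, f x := by
  rw [← Equiv.sum_comp (Equiv.addRight (1 : ZMod q)) f,
    ← sum_range_natCast q (fun x => f (Equiv.addRight (1 : ZMod q) x))]
  refine Finset.sum_nbij' (fun l => l - 1) (fun l => l + 1) ?_ ?_ ?_ ?_ ?_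
  · intro l hl; simp at hl ⊢; omega
  · intro l hl; simp at hl ⊢; omega
  · intro l hl; simp at hl ⊢; omega
  · intro l hl; simp
  · intro l hl
    simp only [Finset.mem_Icc] at hl
    obtain ⟨k, rfl⟩ : ∃ k, l = k + 1 := ⟨l - 1, by omega⟩
    simp

lemma sum_range_mul_periodic (f : ℕ → ℂ) (m : ℕ) (hf : Function.Periodic f m) (g : ℕ) :
    ∑ l ∈ Finset.range (g * m), f l = g * ∑ l ∈ Finset.range m, f l := by
  induction g with
  | zero => simp
  | succ g ih =>
    have h : ∀ x, f (g * m + x) = f x := by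
      intro x
      have := hf.nat_mul g x
      simpa [add_comm] using this
    rw [add_mul, one_mul, Finset.sum_range_add, ih]
    simp_rw [h]
    push_cast
    ring

/-- The cubic Gauss sum as a sum over residue classes. -/
lemma cubicGaussSum_eq_sum (q : ℕ) [NeZero q] (r : ℤ) :
    cubicGaussSum q r = ∑ x : ZMod q, ZMod.stdAddChar ((r : ZMod q) * x ^ 3) := by
  rw [← sum_Icc_natCast q (fun x => (ZMod.stdAddChar ((r : ZMod q) * x ^ 3) : ℂ))]
  refine Finset.sum_congr rfl fun l _ => ?_
  have := ZMod.stdAddChar_coe (N := q) (r * l ^ 3)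
  push_cast at this
  rw [this]
  congr 1
  ring

lemma cubicGaussSum_eq_sum_range (q : ℕ) [NeZero q] (r : ℤ) :
    cubicGaussSum q r =
      ∑ l ∈ Finset.range q, (ZMod.stdAddChar (((r * l ^ 3 : ℤ) : ZMod q)) : ℂ) := by
  rw [cubicGaussSum_eq_sum, ← sum_range_natCast]
  simp

lemma stdAddChar_mul_left (g m : ℕ) [NeZero g] [NeZero m] (t : ℤ) :
    (ZMod.stdAddChar (((g * t : ℤ)) : ZMod (g * m)) : ℂ) = ZMod.stdAddChar ((t : ℤ) : ZMod m) := by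
  have : NeZero (g * m) := ⟨mul_ne_zero (NeZero.ne g) (NeZero.ne m)⟩
  rw [ZMod.stdAddChar_coe, ZMod.stdAddChar_coe]
  have hg : (g : ℂ) ≠ 0 := by exact_mod_cast NeZero.ne g
  have hm : (m : ℂ) ≠ 0 := by exact_mod_cast NeZero.ne m
  congr 1
  push_cast
  field_simp

lemma periodic_stdAddChar_cube (m : ℕ) [NeZero m] (r : ℤ) :
    Function.Periodic
      (fun l : ℕ => (ZMod.stdAddChar (((r * l ^ 3 : ℤ) : ZMod m)) : ℂ)) m := by
  intro l
  simp

/-- The factor g cancels in the fraction gr/(gm), so the summand has period m and the range covers g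
periods. -/
lemma cubicGaussSum_mul (g m : ℕ) [NeZero g] [NeZero m] (r : ℤ) :
    cubicGaussSum (g * m) (g * r) = g * cubicGaussSum m r := by
  have : NeZero (g * m) := ⟨mul_ne_zero (NeZero.ne g) (NeZero.ne m)⟩
  rw [cubicGaussSum_eq_sum_range, cubicGaussSum_eq_sum_range,
    ← sum_range_mul_periodic _ m (periodic_stdAddChar_cube m r)]
  refine Finset.sum_congr rfl fun l _ => ?_
  rw [← stdAddChar_mul_left g m, mul_assoc]

lemma addChar_map_sum {ι R M : Type*} [AddCommMonoid R] [CommMonoid M] (ψ : AddChar R M)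
    (t : Finset ι) (f : ι → R) : ψ (∑ i ∈ t, f i) = ∏ i ∈ t, ψ (f i) := by
  classical
  induction t using Finset.induction_on with
  | empty => simp
  | insert i t hi ih =>
    rw [Finset.sum_insert hi, Finset.prod_insert hi, AddChar.map_add_eq_mul, ih]

variable {s : ℕ}

/-- U depends only on the fractions c/q and d/q: each of the s Gauss sums yields a factor g, and g^s
cancels against the normalisation. -/
lemma U_mul (a b : Fin s → ℤ) (g m : ℕ) [NeZero g] [NeZero m] (c d : ℤ) :
    U a b (g * m) (g * c) (g * d) = U a b m c d := by
  have hg : (g : ℂ) ≠ 0 := by exact_mod_cast NeZero.ne g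
  have h : ∀ j, cubicGaussSum (g * m) (a j * (g * c) + b j * (g * d)) =
      g * cubicGaussSum m (a j * c + b j * d) := by
    intro j
    rw [← cubicGaussSum_mul]
    congr 1
    ring
  unfold U
  simp_rw [h]
  rw [Finset.prod_mul_distrib, Finset.prod_const, Finset.card_univ, Fintype.card_fin]
  push_cast
  rw [mul_pow]
  field_simp

/-- The complete sum of `U` splits according to the reduced denominator. -/
lemma sum_U_eq_sum_divisors (a b : Fin s → ℤ) (q : ℕ) (hq : q ≠ 0) :
    ∑ c ∈ Finset.Icc 1 q, ∑ d ∈ Finset.Icc 1 q, U a b q (c : ℤ) (d : ℤ) =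
      ∑ m ∈ q.divisors, A a b m := by
  -- Replacing m by q/g on the right matches A(q/g) with the pairs (c, d) whose common divisor with
  -- q is exactly g.
  rw [← Nat.sum_div_divisors, ← Finset.sum_product',
    ← Finset.sum_fiberwise_of_maps_to (t := q.divisors)
      (g := fun x : ℕ × ℕ => Nat.gcd (Nat.gcd x.1 x.2) q)]
  · refine Finset.sum_congr rfl fun g hg => ?_
    obtain ⟨m, rfl⟩ := Nat.dvd_of_mem_divisors hg
    have hg0 : g ≠ 0 := by rintro rfl; simp at hq
    have hm0 : m ≠ 0 := by rintro rfl; simp at hq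
    have : NeZero g := ⟨hg0⟩
    have : NeZero m := ⟨hm0⟩
    have hgpos : 0 < g := Nat.pos_of_ne_zero hg0
    rw [Nat.mul_div_cancel_left _ hgpos, A, ← Finset.sum_product', ← Finset.sum_filter]
    refine Finset.sum_nbij' (fun x => (x.1 / g, x.2 / g)) (fun x => (g * x.1, g * x.2))
      ?_ ?_ ?_ ?_ ?_
    · rintro ⟨c, d⟩ h
      simp only [Finset.mem_filter, Finset.mem_product, Finset.mem_Icc] at h ⊢
      obtain ⟨⟨⟨h1, h2⟩, h3, h4⟩, h5⟩ := h
      have hgcd : g ∣ Nat.gcd c d := h5 ▸ Nat.gcd_dvd_left _ _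
      obtain ⟨c, rfl⟩ := hgcd.trans (Nat.gcd_dvd_left _ _)
      obtain ⟨d, rfl⟩ := hgcd.trans (Nat.gcd_dvd_right _ _)
      rw [Nat.gcd_mul_left, Nat.gcd_mul_left] at h5
      rw [Nat.mul_div_cancel_left _ hgpos, Nat.mul_div_cancel_left _ hgpos]
      refine ⟨⟨⟨Nat.pos_of_ne_zero (by rintro rfl; simp at h1),
        Nat.le_of_mul_le_mul_left h2 hgpos⟩, Nat.pos_of_ne_zero (by rintro rfl; simp at h3),
        Nat.le_of_mul_le_mul_left h4 hgpos⟩, ?_⟩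
      exact Nat.eq_of_mul_eq_mul_left hgpos (by simpa using h5)
    · rintro ⟨c, d⟩ h
      simp only [Finset.mem_filter, Finset.mem_product, Finset.mem_Icc] at h ⊢
      obtain ⟨⟨⟨h1, h2⟩, h3, h4⟩, h5⟩ := h
      rw [Nat.gcd_mul_left, Nat.gcd_mul_left, h5]
      exact ⟨⟨⟨Nat.mul_pos hgpos h1, Nat.mul_le_mul_left _ h2⟩, Nat.mul_pos hgpos h3,
        Nat.mul_le_mul_left _ h4⟩, by simp⟩
    · rintro ⟨c, d⟩ h
      simp only [Finset.mem_filter, Finset.mem_product, Finset.mem_Icc] at h ⊢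
      have hgcd : g ∣ Nat.gcd c d := h.2 ▸ Nat.gcd_dvd_left _ _
      rw [Nat.mul_div_cancel' (hgcd.trans (Nat.gcd_dvd_left _ _)),
        Nat.mul_div_cancel' (hgcd.trans (Nat.gcd_dvd_right _ _))]
    · rintro ⟨c, d⟩ h
      simp [Nat.mul_div_cancel_left _ hgpos]
    · rintro ⟨c, d⟩ h
      simp only [Finset.mem_filter, Finset.mem_product, Finset.mem_Icc] at h ⊢
      have hgcd : g ∣ Nat.gcd c d := h.2 ▸ Nat.gcd_dvd_left _ _
      obtain ⟨c, rfl⟩ := hgcd.trans (Nat.gcd_dvd_left _ _)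
      obtain ⟨d, rfl⟩ := hgcd.trans (Nat.gcd_dvd_right _ _)
      rw [Nat.mul_div_cancel_left _ hgpos, Nat.mul_div_cancel_left _ hgpos]
      push_cast
      exact U_mul a b g m c d
  · rintro ⟨c, d⟩ _
    exact Nat.mem_divisors.2 ⟨Nat.gcd_dvd_right _ _, hq⟩

/-- Orthogonality: the complete sum of products of Gauss sums counts solutions. -/
lemma sum_prod_cubicGaussSum (a b : Fin s → ℤ) (q : ℕ) [NeZero q] :
    ∑ c ∈ Finset.Icc 1 q, ∑ d ∈ Finset.Icc 1 q,
      ∏ j, cubicGaussSum q (a j * (c : ℤ) + b j * (d : ℤ)) =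
      (q : ℂ) ^ 2 * solutionCount a b q := by
  classical
  simp_rw [cubicGaussSum_eq_sum]
  push_cast
  rw [sum_Icc_natCast q (fun c : ZMod q => ∑ d ∈ Finset.Icc 1 q,
      ∏ j, ∑ x : ZMod q, (ZMod.stdAddChar (((a j : ZMod q) * c + (b j : ZMod q) * (d : ZMod q)) * x ^ 3) : ℂ))]
  have h1 : ∀ c : ZMod q, ∑ d ∈ Finset.Icc 1 q,
      ∏ j, ∑ x : ZMod q, (ZMod.stdAddChar (((a j : ZMod q) * c + (b j : ZMod q) * (d : ZMod q)) * x ^ 3) : ℂ) =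
      ∑ d : ZMod q, ∏ j, ∑ x : ZMod q,
        (ZMod.stdAddChar (((a j : ZMod q) * c + (b j : ZMod q) * (d : ZMod q)) * x ^ 3) : ℂ) := fun c =>
    sum_Icc_natCast q (fun d : ZMod q => ∏ j, ∑ x : ZMod q,
      (ZMod.stdAddChar (((a j : ZMod q) * c + (b j : ZMod q) * (d : ZMod q)) * x ^ 3) : ℂ))
  simp_rw [h1]
  have h2 : ∀ c d : ZMod q, ∏ j, ∑ x : ZMod q,
      (ZMod.stdAddChar (((a j : ZMod q) * c + (b j : ZMod q) * (d : ZMod q)) * x ^ 3) : ℂ) =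
      ∑ x : Fin s → ZMod q, (ZMod.stdAddChar (c * ∑ j, (a j : ZMod q) * x j ^ 3) : ℂ) *
        ZMod.stdAddChar (d * ∑ j, (b j : ZMod q) * x j ^ 3) := by
    intro c d
    rw [Finset.prod_univ_sum, Fintype.piFinset_univ]
    refine Finset.sum_congr rfl fun x _ => ?_
    rw [← AddChar.map_add_eq_mul, Finset.mul_sum, Finset.mul_sum, ← Finset.sum_add_distrib,
      addChar_map_sum]
    refine Finset.prod_congr rfl fun j _ => ?_
    congr 1
    ring
  simp_rw [h2]
  have h3 : ∀ t : ZMod q, ∑ c : ZMod q, (ZMod.stdAddChar (c * t) : ℂ) =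
      if t = 0 then (q : ℂ) else 0 := by
    intro t
    rw [AddChar.sum_mulShift t (ZMod.isPrimitive_stdAddChar q), ZMod.card]
    split_ifs <;> simp
  calc _ = ∑ x : Fin s → ZMod q, (∑ c : ZMod q, (ZMod.stdAddChar (c * ∑ j, (a j : ZMod q) * x j ^ 3) : ℂ)) *
        ∑ d : ZMod q, ZMod.stdAddChar (d * ∑ j, (b j : ZMod q) * x j ^ 3) := by
        simp_rw [Finset.sum_mul_sum]
        rw [Finset.sum_comm (s := (Finset.univ : Finset (Fin s → ZMod q)))]
        refine Finset.sum_congr rfl fun c _ => ?_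
        rw [Finset.sum_comm]
    _ = ∑ x : Fin s → ZMod q, if IsSolution a b x then (q : ℂ) ^ 2 else 0 := by
        refine Finset.sum_congr rfl fun x _ => ?_
        rw [h3, h3]
        unfold IsSolution
        split_ifs with h4 h5 h6 h6 <;> first | ring1 | (exfalso; tauto)
    _ = _ := by
        rw [← Finset.sum_filter, Finset.sum_const, solutionCount, Nat.card_eq_fintype_card,
          Fintype.card_subtype, nsmul_eq_mul, mul_comm]

/-- The normalised number of solutions modulo `q`. -/
noncomputable def density (a b : Fin s → ℤ) (q : ℕ) : ℝ :=
  (q : ℝ) ^ (2 - (s : ℤ)) * (solutionCount a b q : ℝ)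

lemma normalizedCount_eq_density (a b : Fin s → ℤ) (p h : ℕ) :
    normalizedCount a b p h = density a b (p ^ h) := by
  unfold normalizedCount density
  push_cast
  rw [zpow_mul, zpow_natCast]

/-- The bridge from exponential sums to congruences: orthogonality contributes q^2 and the
normalisation of U contributes q^(-s). -/
lemma sum_divisors_A (a b : Fin s → ℤ) (q : ℕ) (hq : q ≠ 0) :
    ∑ m ∈ q.divisors, A a b m = (density a b q : ℂ) := by
  have : NeZero q := ⟨hq⟩
  have hq' : (q : ℂ) ≠ 0 := by exact_mod_cast hq
  rw [← sum_U_eq_sum_divisors a b q hq]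
  unfold U
  simp_rw [← Finset.mul_sum]
  rw [sum_prod_cubicGaussSum, density]
  push_cast
  rw [zpow_sub₀ hq', zpow_natCast]
  field_simp

/-! ### Multiplicativity -/

lemma solutionCount_mul (a b : Fin s → ℤ) {m n : ℕ} (h : m.Coprime n) :
    solutionCount a b (m * n) = solutionCount a b m * solutionCount a b n := by
  unfold solutionCount
  rw [← Nat.card_prod]
  let e := ZMod.chineseRemainder h
  have key : ∀ (f : Fin s → ℤ) (x : Fin s → ZMod (m * n)),
      ∑ j, (f j : ZMod (m * n)) * x j ^ 3 = 0 ↔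
        (∑ j, (f j : ZMod m) * (e (x j)).1 ^ 3 = 0) ∧
        (∑ j, (f j : ZMod n) * (e (x j)).2 ^ 3 = 0) := by
    intro f x
    rw [← map_eq_zero_iff e e.injective, map_sum, Prod.ext_iff, Prod.fst_sum, Prod.snd_sum]
    simp
  refine Nat.card_congr
    { toFun := fun x => (⟨fun j => (e (x.1 j)).1, ?_⟩, ⟨fun j => (e (x.1 j)).2, ?_⟩)
      invFun := fun y => ⟨fun j => e.symm (y.1.1 j, y.2.1 j), ?_⟩
      left_inv := ?_
      right_inv := ?_ }
  · exact ⟨((key a _).1 x.2.1).1, ((key b _).1 x.2.2).1⟩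
  · exact ⟨((key a _).1 x.2.1).2, ((key b _).1 x.2.2).2⟩
  · refine ⟨(key a _).2 ?_, (key b _).2 ?_⟩
    · simpa using ⟨y.1.2.1, y.2.2.1⟩
    · simpa using ⟨y.1.2.2, y.2.2.2⟩
  · intro x
    ext j
    simp
  · rintro ⟨y, z⟩
    simp

lemma solutionCount_one (a b : Fin s → ℤ) : solutionCount a b 1 = 1 := by
  unfold solutionCount
  rw [Nat.card_eq_one_iff_unique]
  have : Subsingleton (ZMod 1) := inferInstanceAs (Subsingleton (Fin 1))
  exact ⟨⟨fun x y => Subtype.ext (Subsingleton.elim _ _)⟩,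
    ⟨⟨0, Subsingleton.elim _ _, Subsingleton.elim _ _⟩⟩⟩

/-- The normalised number of solutions as an arithmetic function. -/
noncomputable def densityFun (a b : Fin s → ℤ) : ArithmeticFunction ℝ :=
  ⟨fun q => if q = 0 then 0 else density a b q, by simp⟩

lemma densityFun_isMultiplicative (a b : Fin s → ℤ) : (densityFun a b).IsMultiplicative := by
  refine ArithmeticFunction.IsMultiplicative.iff_ne_zero.2 ⟨?_, ?_⟩
  · simp [densityFun, density, solutionCount_one]
  · intro m n hm hn h
    simp only [densityFun, ArithmeticFunction.coe_mk, hm, hn, mul_eq_zero, or_self, if_false]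
    unfold density
    rw [solutionCount_mul a b h]
    push_cast
    rw [mul_zpow]
    ring

/-- The coefficients of the singular series, as a real arithmetic function. -/
noncomputable def seriesFun (a b : Fin s → ℤ) : ArithmeticFunction ℝ :=
  densityFun a b * (ArithmeticFunction.moebius : ArithmeticFunction ℝ)

lemma seriesFun_isMultiplicative (a b : Fin s → ℤ) : (seriesFun a b).IsMultiplicative :=
  (densityFun_isMultiplicative a b).mul ArithmeticFunction.isMultiplicative_moebius.intCast

lemma sum_divisors_seriesFun (a b : Fin s → ℤ) (q : ℕ) (hq : q ≠ 0) :
    ∑ m ∈ q.divisors, seriesFun a b m = density a b q := by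
  have h : seriesFun a b * (ArithmeticFunction.zeta : ArithmeticFunction ℝ) = densityFun a b := by
    rw [seriesFun, mul_assoc, ArithmeticFunction.coe_moebius_mul_coe_zeta, mul_one]
  have h2 := DFunLike.congr_fun h q
  rw [ArithmeticFunction.coe_mul_zeta_apply] at h2
  rw [h2]
  simp [densityFun, hq]

/-- Both sides have the same divisor sums, and these determine a function on the positive integers
by induction. Reality and multiplicativity of A follow. -/
lemma A_eq_seriesFun (a b : Fin s → ℤ) (q : ℕ) : A a b q = (seriesFun a b q : ℂ) := by
  induction q using Nat.strong_induction_on with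
  | _ q ih =>
    rcases eq_or_ne q 0 with rfl | hq
    · simp [A]
    · have h1 := sum_divisors_A a b q hq
      rw [← sum_divisors_seriesFun a b q hq] at h1
      push_cast at h1
      rw [← Nat.cons_self_properDivisors hq, Finset.sum_cons, Finset.sum_cons] at h1
      rw [Finset.sum_congr rfl fun m hm => ih m (Nat.mem_properDivisors.1 hm).2] at h1
      exact add_right_cancel h1

lemma density_prime_pow (a b : Fin s → ℤ) {p : ℕ} (hp : p.Prime) (h : ℕ) :
    density a b (p ^ h) = ∑ k ∈ Finset.range (h + 1), seriesFun a b (p ^ k) := by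
  rw [← sum_divisors_seriesFun a b _ (pow_ne_zero _ hp.ne_zero), Nat.sum_divisors_prime_pow hp]

end CubicPair

namespace CubicPair

/-! ### Bounds for Gauss sums -/

lemma card_cube_eq_le {F : Type*} [Field F] [Fintype F] [DecidableEq F] (c : F) :
    (Finset.univ.filter fun x : F => x ^ 3 = c).card ≤ 3 := by
  calc _ ≤ (Polynomial.nthRoots 3 c).toFinset.card := by
        refine Finset.card_le_card fun x hx => ?_
        rw [Multiset.mem_toFinset, Polynomial.mem_nthRoots (by norm_num)]
        simpa using hx
    _ ≤ (Polynomial.nthRoots 3 c).card := Multiset.toFinset_card_le _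
    _ ≤ 3 := Polynomial.card_nthRoots 3 c

lemma sum_comp_cube_le {F : Type*} [Field F] [Fintype F] [DecidableEq F] (g : F → ℝ)
    (hg : ∀ v, 0 ≤ g v) {u : F} (hu : u ≠ 0) : ∑ t : F, g (u * t ^ 3) ≤ 3 * ∑ v, g v := by
  rw [← Finset.sum_fiberwise_of_maps_to (t := Finset.univ) (g := fun t : F => u * t ^ 3)
    (fun _ _ => Finset.mem_univ _), Finset.mul_sum]
  refine Finset.sum_le_sum fun v _ => ?_
  rw [Finset.sum_congr rfl (g := fun _ => g v) (fun t ht => by rw [(Finset.mem_filter.1 ht).2]),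
    Finset.sum_const, nsmul_eq_mul]
  refine mul_le_mul_of_nonneg_right ?_ (hg v)
  have : (Finset.univ.filter fun t : F => u * t ^ 3 = v) =
      Finset.univ.filter fun t : F => t ^ 3 = v / u := by
    ext t
    simp only [Finset.mem_filter, Finset.mem_univ, true_and]
    rw [eq_div_iff hu, mul_comm]
  rw [this]
  exact_mod_cast card_cube_eq_le (v / u)

/-- Substituting x ↦ tx shows that |G| is constant along r t^3, t ≠ 0. The second moment of G is p
#{x^3 = y^3} ≤ 3p^2, and t ↦ r t^3 is at most 3-to-1, so (p - 1)|G(r)|^2 ≤ 9p^2; finally p - 1 ≥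
p/2. -/
lemma norm_sq_cubicGaussSum_prime_le {p : ℕ} (hp : p.Prime) {r : ℤ} (hr : ¬ (p : ℤ) ∣ r) :
    ‖cubicGaussSum p r‖ ^ 2 ≤ 18 * p := by
  have : Fact p.Prime := ⟨hp⟩
  have : NeZero p := ⟨hp.ne_zero⟩
  set G : ZMod p → ℂ := fun u => ∑ x : ZMod p, (ZMod.stdAddChar (u * x ^ 3) : ℂ) with hG
  have hr0 : (r : ZMod p) ≠ 0 := by rwa [Ne, ZMod.intCast_zmod_eq_zero_iff_dvd]
  have hinv : ∀ u t : ZMod p, t ≠ 0 → G (u * t ^ 3) = G u := by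
    intro u t ht
    simp only [hG]
    exact Fintype.sum_equiv (Equiv.mulLeft₀ t ht) _ _ fun x => by simp [mul_pow, mul_assoc]
  have htot : ∑ u, ‖G u‖ ^ 2 ≤ 3 * (p : ℝ) ^ 2 := by
    have h1 : ((∑ u, ‖G u‖ ^ 2 : ℝ) : ℂ) = (p : ℂ) *
        (∑ y : ZMod p, ((Finset.univ.filter fun x : ZMod p => x ^ 3 = y ^ 3).card : ℂ)) := by
      push_cast
      have h2 : ∀ u, (‖G u‖ : ℂ) ^ 2 =
          ∑ y : ZMod p, ∑ x : ZMod p, (ZMod.stdAddChar (u * (x ^ 3 - y ^ 3)) : ℂ) := by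
        intro u
        rw [← Complex.mul_conj', hG]
        simp only [map_sum]
        rw [Finset.sum_mul_sum, Finset.sum_comm]
        refine Finset.sum_congr rfl fun y _ => Finset.sum_congr rfl fun x _ => ?_
        rw [← AddChar.map_neg_eq_conj, ← AddChar.map_add_eq_mul]
        congr 1
        ring
      simp_rw [h2]
      rw [Finset.sum_comm, Finset.mul_sum]
      refine Finset.sum_congr rfl fun y _ => ?_
      rw [Finset.sum_comm]
      have h3 : ∀ x : ZMod p, ∑ u : ZMod p, (ZMod.stdAddChar (u * (x ^ 3 - y ^ 3)) : ℂ) =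
          if x ^ 3 = y ^ 3 then (p : ℂ) else 0 := by
        intro x
        rw [AddChar.sum_mulShift _ (ZMod.isPrimitive_stdAddChar p), ZMod.card]
        simp only [sub_eq_zero]
        split_ifs <;> simp
      simp_rw [h3]
      rw [← Finset.sum_filter, Finset.sum_const, nsmul_eq_mul, mul_comm]
    have h2 : (∑ u, ‖G u‖ ^ 2 : ℝ) = (p : ℝ) *
        (∑ y : ZMod p, ((Finset.univ.filter fun x : ZMod p => x ^ 3 = y ^ 3).card : ℝ)) := by
      exact_mod_cast h1
    rw [h2]
    have h3 : (∑ y : ZMod p, ((Finset.univ.filter fun x : ZMod p => x ^ 3 = y ^ 3).card : ℝ)) ≤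
        ∑ _y : ZMod p, (3 : ℝ) :=
      Finset.sum_le_sum fun y _ => by exact_mod_cast card_cube_eq_le (y ^ 3)
    rw [Finset.sum_const, Finset.card_univ, ZMod.card, nsmul_eq_mul] at h3
    nlinarith [Nat.cast_nonneg (α := ℝ) p]
  have h1 : ((p : ℝ) - 1) * ‖G r‖ ^ 2 ≤ 9 * (p : ℝ) ^ 2 := by
    calc ((p : ℝ) - 1) * ‖G r‖ ^ 2
        = ∑ t ∈ Finset.univ.erase (0 : ZMod p), ‖G (r * t ^ 3)‖ ^ 2 := by
          rw [Finset.sum_congr rfl fun t ht => by rw [hinv r t (Finset.ne_of_mem_erase ht)],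
            Finset.sum_const, Finset.card_erase_of_mem (Finset.mem_univ _), Finset.card_univ,
            ZMod.card, nsmul_eq_mul, Nat.cast_sub hp.one_le, Nat.cast_one]
      _ ≤ ∑ t, ‖G (r * t ^ 3)‖ ^ 2 :=
          Finset.sum_le_sum_of_subset_of_nonneg (Finset.erase_subset _ _)
            fun _ _ _ => sq_nonneg _
      _ ≤ 3 * ∑ v, ‖G v‖ ^ 2 := sum_comp_cube_le (fun v => ‖G v‖ ^ 2) (fun _ => sq_nonneg _) hr0
      _ ≤ _ := by linarith
  have h2 : G r = cubicGaussSum p r := (cubicGaussSum_eq_sum p r).symm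
  rw [h2] at h1
  have hp2 : (2 : ℝ) ≤ p := by exact_mod_cast hp.two_le
  have h3 : (p : ℝ) / 2 * ‖cubicGaussSum p r‖ ^ 2 ≤ 9 * (p : ℝ) ^ 2 :=
    le_trans (mul_le_mul_of_nonneg_right (by linarith) (sq_nonneg _)) h1
  nlinarith

/-- Averaging over the shifts `x ↦ x + δ z` leaves only the terms with `q ∣ 3 r δ x ^ 2`. -/
lemma cubicGaussSum_eq_sum_of_shift (q : ℕ) [NeZero q] (r : ℤ) (δ : ℕ) (h2 : q ∣ 3 * δ ^ 2)
    (h3 : q ∣ δ ^ 3) :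
    cubicGaussSum q r = ∑ l ∈ Finset.range q,
      if (q : ℤ) ∣ 3 * r * δ * l ^ 2 then (ZMod.stdAddChar (((r * l ^ 3 : ℤ) : ZMod q)) : ℂ)
        else 0 := by
  have e2 : (3 : ZMod q) * (δ : ZMod q) ^ 2 = 0 := by
    have := (ZMod.natCast_eq_zero_iff (3 * δ ^ 2) q).2 h2
    exact_mod_cast this
  have e3 : (δ : ZMod q) ^ 3 = 0 := by
    have := (ZMod.natCast_eq_zero_iff (δ ^ 3) q).2 h3
    exact_mod_cast this
  have hq : (q : ℂ) ≠ 0 := by exact_mod_cast NeZero.ne q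
  refine mul_left_cancel₀ hq ?_
  calc (q : ℂ) * cubicGaussSum q r
      = ∑ z : ZMod q, ∑ x : ZMod q, (ZMod.stdAddChar ((r : ZMod q) * (x + (δ : ZMod q) * z) ^ 3) : ℂ) := by
        rw [Finset.sum_congr rfl (g := fun _ => cubicGaussSum q r), Finset.sum_const,
          Finset.card_univ, ZMod.card, nsmul_eq_mul]
        intro z _
        rw [cubicGaussSum_eq_sum]
        exact Fintype.sum_equiv (Equiv.addRight ((δ : ZMod q) * z)) _ _ fun x => by simp
    _ = ∑ x : ZMod q, ∑ z : ZMod q, (ZMod.stdAddChar ((r : ZMod q) * x ^ 3) : ℂ) *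
          ZMod.stdAddChar (z * ((3 : ZMod q) * (r : ZMod q) * (δ : ZMod q) * x ^ 2)) := by
        rw [Finset.sum_comm]
        refine Finset.sum_congr rfl fun x _ => Finset.sum_congr rfl fun z _ => ?_
        rw [← AddChar.map_add_eq_mul]
        congr 1
        -- Modulo q only the constant and linear terms in z of the expanded cube survive.
        linear_combination ((r : ZMod q) * x * z ^ 2) * e2 + ((r : ZMod q) * z ^ 3) * e3
    _ = ∑ x : ZMod q, (q : ℂ) * if (3 : ZMod q) * (r : ZMod q) * (δ : ZMod q) * x ^ 2 = 0 then
          (ZMod.stdAddChar ((r : ZMod q) * x ^ 3) : ℂ) else 0 := by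
        refine Finset.sum_congr rfl fun x _ => ?_
        rw [← Finset.mul_sum, AddChar.sum_mulShift _ (ZMod.isPrimitive_stdAddChar q), ZMod.card]
        split_ifs <;> simp [mul_comm]
    _ = _ := by
        rw [← Finset.mul_sum, ← sum_range_natCast]
        congr 1
        refine Finset.sum_congr rfl fun l _ => ?_
        have : ((3 : ZMod q) * (r : ZMod q) * (δ : ZMod q) * (l : ZMod q) ^ 2 = 0) ↔ (q : ℤ) ∣ 3 * r * δ * l ^ 2 := by
          rw [← ZMod.intCast_zmod_eq_zero_iff_dvd]
          push_cast
          rfl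
        simp only [this]
        push_cast
        rfl

lemma sum_range_ite_dvd {M : Type*} [AddCommMonoid M] (p m : ℕ) (hp : 0 < p) (f : ℕ → M) :
    (∑ l ∈ Finset.range (p * m), if p ∣ l then f l else 0) = ∑ l ∈ Finset.range m, f (p * l) := by
  rw [← Finset.sum_filter]
  refine Finset.sum_nbij' (fun l => l / p) (fun l => p * l) ?_ ?_ ?_ ?_ ?_
  · intro l hl
    simp only [Finset.mem_filter, Finset.mem_range] at hl ⊢
    exact Nat.div_lt_of_lt_mul hl.1
  · intro l hl
    simp only [Finset.mem_filter, Finset.mem_range] at hl ⊢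
    exact ⟨Nat.mul_lt_mul_of_pos_left hl hp, dvd_mul_right _ _⟩
  · intro l hl
    exact Nat.mul_div_cancel' (Finset.mem_filter.1 hl).2
  · intro l _
    exact Nat.mul_div_cancel_left _ hp
  · intro l hl
    rw [Nat.mul_div_cancel' (Finset.mem_filter.1 hl).2]

lemma cubicGaussSum_eq_sum_multiples {p : ℕ} (hp : 0 < p) (m : ℕ) [NeZero (p * m)] (r : ℤ) (δ : ℕ)
    (h2 : p * m ∣ 3 * δ ^ 2) (h3 : p * m ∣ δ ^ 3)
    (h : ∀ l : ℤ, ((p * m : ℕ) : ℤ) ∣ 3 * r * δ * l ^ 2 ↔ (p : ℤ) ∣ l) :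
    cubicGaussSum (p * m) r = ∑ l ∈ Finset.range m,
      (ZMod.stdAddChar (((r * ((p * l : ℕ) : ℤ) ^ 3 : ℤ) : ZMod (p * m))) : ℂ) := by
  rw [cubicGaussSum_eq_sum_of_shift (p * m) r δ h2 h3, ← sum_range_ite_dvd p m hp
    (fun l => (ZMod.stdAddChar (((r * (l : ℤ) ^ 3 : ℤ) : ZMod (p * m))) : ℂ))]
  refine Finset.sum_congr rfl fun l _ => ?_
  simp only [h, Int.natCast_dvd_natCast]

lemma stdAddChar_congr {m n : ℕ} [NeZero m] [NeZero n] (h : m = n) (t : ℤ) :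
    (ZMod.stdAddChar (t : ZMod m) : ℂ) = ZMod.stdAddChar (t : ZMod n) := by
  subst h
  rfl

lemma dvd_shift_iff_of_ne_three {p : ℕ} (hp : p.Prime) (hp3 : p ≠ 3) {r : ℤ}
    (hr : ¬ (p : ℤ) ∣ r) (k : ℕ) (l : ℤ) :
    ((p * p ^ k : ℕ) : ℤ) ∣ 3 * r * (p ^ k : ℕ) * l ^ 2 ↔ (p : ℤ) ∣ l := by
  have hpp : Prime (p : ℤ) := Nat.prime_iff_prime_int.1 hp
  have hpk : ((p ^ k : ℕ) : ℤ) ≠ 0 := by exact_mod_cast pow_ne_zero _ hp.ne_zero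
  have h3 : ¬ (p : ℤ) ∣ 3 := by
    intro h
    have : p ∣ 3 := by exact_mod_cast h
    exact hp3 ((Nat.prime_dvd_prime_iff_eq hp Nat.prime_three).1 this)
  rw [Nat.cast_mul, show 3 * r * ((p ^ k : ℕ) : ℤ) * l ^ 2 = (3 * r * l ^ 2) * ((p ^ k : ℕ) : ℤ) by
    ring, mul_dvd_mul_iff_right hpk, hpp.dvd_mul, hpp.dvd_mul, hpp.dvd_pow_iff_dvd two_ne_zero]
  tauto

lemma dvd_shift_iff_three {r : ℤ} (hr : ¬ (3 : ℤ) ∣ r) (k : ℕ) (l : ℤ) :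
    ((3 * 3 ^ (k + 1) : ℕ) : ℤ) ∣ 3 * r * (3 ^ k : ℕ) * l ^ 2 ↔ (3 : ℤ) ∣ l := by
  have hpp : Prime (3 : ℤ) := Int.prime_three
  have hpk : (3 : ℤ) ^ (k + 1) ≠ 0 := pow_ne_zero _ (by norm_num)
  push_cast
  rw [show 3 * r * (3 : ℤ) ^ k * l ^ 2 = (r * l ^ 2) * 3 ^ (k + 1) by ring,
    mul_dvd_mul_iff_right hpk, hpp.dvd_mul, hpp.dvd_pow_iff_dvd two_ne_zero]
  tauto

/-- Only l = p l' survives the averaging over shifts; then r l^3 / p^(k+3) = r l'^3 / p^k, and l'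
runs over p^2 full periods. -/
lemma cubicGaussSum_prime_pow_add_three {p : ℕ} (hp : p.Prime) {r : ℤ} (hr : ¬ (p : ℤ) ∣ r)
    (k : ℕ) : cubicGaussSum (p ^ (k + 3)) r = (p : ℂ) ^ 2 * cubicGaussSum (p ^ k) r := by
  have : NeZero p := ⟨hp.ne_zero⟩
  have hpp : p ^ (k + 3) = p * p ^ (k + 2) := by ring
  rw [hpp]
  have : NeZero (p * p ^ (k + 2)) := ⟨hpp ▸ pow_ne_zero _ hp.ne_zero⟩
  have key : cubicGaussSum (p * p ^ (k + 2)) r = ∑ l ∈ Finset.range (p ^ (k + 2)),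
      (ZMod.stdAddChar (((r * ((p * l : ℕ) : ℤ) ^ 3 : ℤ) : ZMod (p * p ^ (k + 2)))) : ℂ) := by
    rcases eq_or_ne p 3 with rfl | hp3
    -- At p = 3 the coefficient 3 of the linear term already supplies one power of p, so the shift
    -- has one power fewer than for other primes.
    · refine cubicGaussSum_eq_sum_multiples hp.pos _ r (3 ^ (k + 1)) ?_ ?_
        (dvd_shift_iff_three hr (k + 1))
      · exact ⟨3 ^ k, by ring⟩
      · exact ⟨3 ^ (2 * k), by ring⟩
    · refine cubicGaussSum_eq_sum_multiples hp.pos _ r (p ^ (k + 2)) ?_ ?_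
        (dvd_shift_iff_of_ne_three hp hp3 hr (k + 2))
      · exact ⟨3 * p ^ (k + 1), by ring⟩
      · exact ⟨p ^ (2 * k + 3), by ring⟩
  have hpk : p ^ (k + 2) = p ^ 2 * p ^ k := by ring
  rw [key, cubicGaussSum_eq_sum_range (p ^ k) r,
    Finset.sum_congr (congrArg Finset.range hpk) fun _ _ => rfl]
  have h4 := sum_range_mul_periodic _ (p ^ k) (periodic_stdAddChar_cube (p ^ k) r) (p ^ 2)
  push_cast at h4 ⊢
  rw [← h4]
  refine Finset.sum_congr rfl fun l _ => ?_
  have h5 := stdAddChar_mul_left (p ^ 3) (p ^ k) (r * l ^ 3)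
  have hpk' : p * p ^ (k + 2) = p ^ 3 * p ^ k := by ring
  have h6 := stdAddChar_congr hpk' (((p ^ 3 : ℕ) : ℤ) * (r * l ^ 3))
  rw [← h6] at h5
  push_cast at h5
  rw [← h5]
  congr 1
  ring

lemma norm_cubicGaussSum_le_self (q : ℕ) [NeZero q] (r : ℤ) : ‖cubicGaussSum q r‖ ≤ q := by
  rw [cubicGaussSum_eq_sum_range]
  refine (norm_sum_le _ _).trans ?_
  simp

/-- For p ≠ 3 only the p multiples of p survive, each of modulus 1; for p = 3 the bound is the
trivial one. -/
lemma norm_cubicGaussSum_prime_sq_le {p : ℕ} (hp : p.Prime) {r : ℤ} (hr : ¬ (p : ℤ) ∣ r) :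
    ‖cubicGaussSum (p ^ 2) r‖ ≤ 3 * p := by
  have : NeZero p := ⟨hp.ne_zero⟩
  rcases eq_or_ne p 3 with rfl | hp3
  · refine (norm_cubicGaussSum_le_self _ _).trans ?_
    norm_num
  · have : NeZero (p * p ^ 1) := ⟨by simp [hp.ne_zero]⟩
    rw [show p ^ 2 = p * p ^ 1 by ring, cubicGaussSum_eq_sum_multiples hp.pos _ r (p ^ 1)
      ⟨3, by ring⟩ ⟨p, by ring⟩ (dvd_shift_iff_of_ne_three hp hp3 hr 1)]
    refine (norm_sum_le _ _).trans ?_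
    simp
    linarith [Nat.cast_nonneg (α := ℝ) p]

/-- The bound `S(q, r) ≪ q ^ (2 / 3) (q, r) ^ (1 / 3)` for prime powers `q`, cubed. -/
theorem norm_cubicGaussSum_prime_pow_le {p : ℕ} (hp : p.Prime) (h : ℕ) (r : ℤ) :
    ‖cubicGaussSum (p ^ h) r‖ ^ 3 ≤ 64 * (p : ℝ) ^ (2 * h) * Int.gcd (p ^ h : ℕ) r := by
  have : NeZero p := ⟨hp.ne_zero⟩
  have hp0 : (0 : ℝ) < p := by exact_mod_cast hp.pos
  induction h using Nat.strong_induction_on generalizing r with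
  | _ h ih =>
    -- If p ∣ r, cancelling p divides both sides by p^3. Otherwise lowering the exponent by three
    -- divides both by p^6, down to the exponents 0, 1, 2.
    by_cases hr : (p : ℤ) ∣ r
    · obtain ⟨r, rfl⟩ := hr
      rcases h with _ | h
      · have := norm_cubicGaussSum_le_self 1 (p * r)
        simp only [pow_zero, mul_zero, Nat.cast_one, mul_one] at this ⊢
        rw [Int.one_gcd]
        have h2 := pow_le_one₀ (norm_nonneg _) this (n := 3)
        norm_num
        linarith
      · have h1 := ih h (by omega) r
        have e : p ^ (h + 1) = p * p ^ h := by ring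
        rw [e, cubicGaussSum_mul, norm_mul, mul_pow, Nat.cast_mul, Int.gcd_mul_left]
        simp only [Complex.norm_natCast, Int.natAbs_natCast]
        push_cast at h1 ⊢
        calc (p : ℝ) ^ 3 * ‖cubicGaussSum (p ^ h) r‖ ^ 3
            ≤ (p : ℝ) ^ 3 * (64 * (p : ℝ) ^ (2 * h) * (Int.gcd ((p : ℤ) ^ h) r)) := by gcongr
          _ = _ := by ring
    · have hg : (1 : ℝ) ≤ Int.gcd (p ^ h : ℕ) r := by
        have : 0 < Int.gcd (p ^ h : ℕ) r := Int.gcd_pos_of_ne_zero_left _ (by simp [hp.ne_zero])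
        exact_mod_cast this
      suffices h1 : ‖cubicGaussSum (p ^ h) r‖ ^ 3 ≤ 64 * (p : ℝ) ^ (2 * h) by
        refine h1.trans (le_mul_of_one_le_right (by positivity) hg)
      have hp2 : (2 : ℝ) ≤ p := by exact_mod_cast hp.two_le
      match h, ih with
      | 0, _ =>
        have := norm_cubicGaussSum_le_self 1 r
        have h2 := pow_le_one₀ (norm_nonneg _) (by simpa using this) (n := 3)
        simp only [pow_zero, mul_zero, mul_one]
        linarith
      | 1, _ =>
        have h1 := norm_sq_cubicGaussSum_prime_le hp hr
        simp only [pow_one, mul_one]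
        have h2 : (‖cubicGaussSum p r‖ ^ 3) ^ 2 ≤ (64 * (p : ℝ) ^ 2) ^ 2 := by
          calc (‖cubicGaussSum p r‖ ^ 3) ^ 2 = (‖cubicGaussSum p r‖ ^ 2) ^ 3 := by ring
            _ ≤ (18 * (p : ℝ)) ^ 3 := by gcongr
            -- 18^3 = 2916 · 2; the 2 is absorbed by p, and 2916 ≤ 64^2.
            _ = 2916 * (p : ℝ) ^ 3 * 2 := by ring
            _ ≤ 2916 * (p : ℝ) ^ 3 * p := by gcongr
            _ ≤ (64 * (p : ℝ) ^ 2) ^ 2 := by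
              have : (0 : ℝ) ≤ (p : ℝ) ^ 4 := by positivity
              linarith
        exact le_of_sq_le_sq h2 (by positivity)
      | 2, _ =>
        have h1 := norm_cubicGaussSum_prime_sq_le hp hr
        calc ‖cubicGaussSum (p ^ 2) r‖ ^ 3 ≤ (3 * (p : ℝ)) ^ 3 := by gcongr
          _ = 27 * (p : ℝ) ^ 3 * 1 := by ring
          _ ≤ 64 * (p : ℝ) ^ 3 * p := by gcongr <;> linarith
          _ = _ := by ring
      | k + 3, ih =>
        rw [cubicGaussSum_prime_pow_add_three hp hr, norm_mul, mul_pow, norm_pow]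
        simp only [Complex.norm_natCast]
        have h1 := ih k (by omega) r
        have h2 : Int.gcd (p ^ k : ℕ) r = 1 := by
          rw [Int.gcd_eq_natAbs, Int.natAbs_natCast]
          refine Nat.Coprime.pow_left _ ((Nat.Prime.coprime_iff_not_dvd hp).2 ?_)
          rwa [← Int.natCast_dvd]
        rw [h2] at h1
        calc ((p : ℝ) ^ 2) ^ 3 * ‖cubicGaussSum (p ^ k) r‖ ^ 3
            ≤ ((p : ℝ) ^ 2) ^ 3 * (64 * (p : ℝ) ^ (2 * k) * (1 : ℕ)) := by gcongr
          _ = _ := by push_cast; ring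

end CubicPair

namespace CubicPair

/-! ### Bounds for the coefficients of the singular series -/

lemma card_Ioc_filter_dvd_mul (x : ℤ) (L m : ℕ) (hm : 0 < m) :
    ((Finset.Ioc x (x + (m * L : ℕ))).filter fun n => (m : ℤ) ∣ n).card = L := by
  have h := Int.Ioc_filter_dvd_card x (x + (m * L : ℕ)) (r := (m : ℤ)) (by exact_mod_cast hm)
  have hm' : (m : ℚ) ≠ 0 := by exact_mod_cast hm.ne'
  have e : (((x + (m * L : ℕ) : ℤ) : ℚ) / ((m : ℤ) : ℚ)) = (x : ℚ) / ((m : ℤ) : ℚ) + (L : ℕ) := by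
    push_cast
    field_simp
  rw [e, Int.floor_add_natCast] at h
  simp at h
  exact h

/-- The map c ↦ ac + t injects into the interval (t, t + aq], which contains exactly aq/m multiples
of m. -/
lemma card_filter_dvd_linear_mul_le_of_pos (a t : ℤ) (ha : 0 < a) (q m : ℕ) (hm : 0 < m)
    (hmq : m ∣ q) :
    ((Finset.Icc 1 q).filter fun c : ℕ => (m : ℤ) ∣ a * c + t).card * m ≤ a.natAbs * q := by
  obtain ⟨k, rfl⟩ := hmq
  obtain ⟨n, rfl⟩ := Int.eq_ofNat_of_zero_le ha.le
  rw [Int.natAbs_natCast, show n * (m * k) = (n * k) * m by ring]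
  refine Nat.mul_le_mul_right _ ?_
  rw [← card_Ioc_filter_dvd_mul t (n * k) m hm]
  refine Finset.card_le_card_of_injOn (fun c : ℕ => (n : ℤ) * c + t) ?_ ?_
  · intro c hc
    simp only [Finset.coe_filter, Finset.mem_Icc, Set.mem_ofPred_eq, Finset.mem_Ioc] at hc ⊢
    obtain ⟨⟨h1, h2⟩, h3⟩ := hc
    refine ⟨⟨?_, ?_⟩, h3⟩
    · have : (0 : ℤ) < n * c := mul_pos ha (by exact_mod_cast h1)
      linarith
    · have h4 : n * c ≤ n * (m * k) := Nat.mul_le_mul_left _ h2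
      have h5 : (n : ℤ) * c ≤ n * (m * k) := by exact_mod_cast h4
      push_cast
      linarith
  · intro c _ d _ h
    have hn : (n : ℤ) ≠ 0 := ha.ne'
    have h' := add_right_cancel h
    exact_mod_cast mul_left_cancel₀ hn h'

lemma card_filter_dvd_linear_mul_le (a t : ℤ) (ha : a ≠ 0) (q m : ℕ) (hm : 0 < m) (hmq : m ∣ q) :
    ((Finset.Icc 1 q).filter fun c : ℕ => (m : ℤ) ∣ a * c + t).card * m ≤ a.natAbs * q := by
  rcases lt_or_gt_of_ne ha with h | h
  · have := card_filter_dvd_linear_mul_le_of_pos (-a) (-t) (by omega) q m hm hmq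
    rw [Int.natAbs_neg] at this
    simp_rw [show ∀ c : ℕ, -a * (c : ℤ) + -t = -(a * c + t) by intro c; ring, dvd_neg] at this
    exact this
  · exact card_filter_dvd_linear_mul_le_of_pos a t h q m hm hmq

lemma gcd_prime_pow_eq {p : ℕ} (hp : p.Prime) (h : ℕ) (n : ℤ) :
    ∃ k ≤ h, Int.gcd (p ^ h : ℕ) n = p ^ k := by
  have : Int.gcd (p ^ h : ℕ) n ∣ p ^ h := by
    rw [Int.gcd_eq_natAbs, Int.natAbs_natCast]
    exact Nat.gcd_dvd_left _ _
  exact (Nat.dvd_prime_pow hp).1 this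

/-- The square of the gcd is at most the sum of p^(2k) over all k ≤ h with p^k dividing the form.
Each of the h + 1 levels contributes at most |a| p^h p^k ≤ |a| p^(2h). -/
lemma sum_gcd_sq_le {p : ℕ} (hp : p.Prime) (h : ℕ) (a t : ℤ) (ha : a ≠ 0) :
    ∑ c ∈ Finset.Icc 1 (p ^ h), (Int.gcd (p ^ h : ℕ) (a * c + t)) ^ 2 ≤
      a.natAbs * (h + 1) * (p ^ h) ^ 2 := by
  calc ∑ c ∈ Finset.Icc 1 (p ^ h), (Int.gcd (p ^ h : ℕ) (a * c + t)) ^ 2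
      ≤ ∑ c ∈ Finset.Icc 1 (p ^ h), ∑ k ∈ Finset.range (h + 1),
          if ((p ^ k : ℕ) : ℤ) ∣ a * c + t then (p ^ k) ^ 2 else 0 := by
        refine Finset.sum_le_sum fun c _ => ?_
        obtain ⟨k, hk, hk2⟩ := gcd_prime_pow_eq hp h (a * c + t)
        rw [hk2]
        refine le_trans ?_ (Finset.single_le_sum (fun _ _ => Nat.zero_le _)
          (Finset.mem_range.2 (Nat.lt_succ_of_le hk)))
        rw [if_pos (by rw [← hk2]; exact Int.gcd_dvd_right _ _)]
    _ = ∑ k ∈ Finset.range (h + 1), ((Finset.Icc 1 (p ^ h)).filter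
          fun c : ℕ => ((p ^ k : ℕ) : ℤ) ∣ a * c + t).card * p ^ k * p ^ k := by
        rw [Finset.sum_comm]
        refine Finset.sum_congr rfl fun k _ => ?_
        rw [← Finset.sum_filter, Finset.sum_const, smul_eq_mul]
        ring
    _ ≤ ∑ k ∈ Finset.range (h + 1), a.natAbs * p ^ h * p ^ h := by
        refine Finset.sum_le_sum fun k hk => ?_
        have hk' : k ≤ h := Nat.lt_succ_iff.1 (Finset.mem_range.1 hk)
        exact Nat.mul_le_mul (card_filter_dvd_linear_mul_le a t ha _ _ (pow_pos hp.pos _)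
          (pow_dvd_pow _ hk')) (Nat.pow_le_pow_right hp.pos hk')
    _ = _ := by
        rw [Finset.sum_const, Finset.card_range, smul_eq_mul]
        ring

lemma sum_sum_gcd_sq_le {p : ℕ} (hp : p.Prime) (h : ℕ) (a b : ℤ) (hab : (a, b) ≠ (0, 0)) :
    ∑ c ∈ Finset.Icc 1 (p ^ h), ∑ d ∈ Finset.Icc 1 (p ^ h),
      (Int.gcd (p ^ h : ℕ) (a * c + b * d)) ^ 2 ≤
      (a.natAbs + b.natAbs) * (h + 1) * (p ^ h) ^ 3 := by
  have key : ∀ x y : ℤ, x ≠ 0 → ∑ d ∈ Finset.Icc 1 (p ^ h), ∑ c ∈ Finset.Icc 1 (p ^ h),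
      (Int.gcd (p ^ h : ℕ) (x * c + y * d)) ^ 2 ≤ x.natAbs * (h + 1) * (p ^ h) ^ 3 := by
    intro x y hx
    refine (Finset.sum_le_sum fun (d : ℕ) _ => sum_gcd_sq_le hp h x (y * d) hx).trans ?_
    rw [Finset.sum_const, Nat.card_Icc, smul_eq_mul, Nat.add_sub_cancel]
    apply le_of_eq
    ring
  -- The inner sum is taken over a variable with nonzero coefficient; the other variable costs a
  -- factor p^h.
  by_cases ha : a = 0
  · have hb : b ≠ 0 := by
      rintro rfl
      exact hab (by rw [ha])
    have := key b a hb
    simp_rw [add_comm (b * _) (a * _)] at this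
    refine this.trans ?_
    gcongr
    omega
  · rw [Finset.sum_comm]
    refine (key a b ha).trans ?_
    gcongr
    omega

variable {s : ℕ}

/-- The `2 × 2` minors of the coefficient matrix. -/
def minor (a b : Fin s → ℤ) (i j : Fin s) : ℤ := a i * b j - a j * b i

/-- A positive integer exceeding all minors in absolute value. -/
def minorBound (a b : Fin s → ℤ) : ℕ := 1 + ∑ i, ∑ j, (minor a b i j).natAbs

lemma natAbs_minor_le (a b : Fin s → ℤ) (i j : Fin s) :
    (minor a b i j).natAbs ≤ minorBound a b := by
  have h1 := Finset.single_le_sum (f := fun j => (minor a b i j).natAbs)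
    (fun _ _ => Nat.zero_le _) (Finset.mem_univ j)
  have h2 := Finset.single_le_sum (f := fun i => ∑ j, (minor a b i j).natAbs)
    (fun _ _ => Nat.zero_le _) (Finset.mem_univ i)
  unfold minorBound
  omega

/-- Few columns are proportional to a given one. -/
lemma card_minor_eq_zero_le (a b : Fin s → ℤ) (hab : ∀ j, (a j, b j) ≠ (0, 0))
    (hs : 13 ≤ s) (hL : ∀ c d : ℤ, (c, d) ≠ (0, 0) →
      s - 6 ≤ (Finset.univ.filter (fun j : Fin s => c * a j + d * b j ≠ 0)).card) (i : Fin s) :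
    (Finset.univ.filter fun j => minor a b i j = 0).card ≤ 6 := by
  -- With (c, d) = (-b_i, a_i) the form c a_j + d b_j is the minor of columns i and j.
  have h1 := hL (-b i) (a i) (by
    intro h
    apply hab i
    simp only [Prod.mk.injEq, neg_eq_zero] at h ⊢
    exact ⟨h.2, h.1⟩)
  have h2 := Finset.card_filter_add_card_filter_not
    (s := (Finset.univ : Finset (Fin s))) (fun j => minor a b i j = 0)
  rw [Finset.card_univ, Fintype.card_fin] at h2
  have h3 : (Finset.univ.filter (fun j : Fin s => -b i * a j + a i * b j ≠ 0)) =
      Finset.univ.filter fun j => ¬ minor a b i j = 0 := by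
    refine Finset.filter_congr fun j _ => ?_
    rw [minor, show -b i * a j + a i * b j = a i * b j - a j * b i by ring]
  rw [h3] at h1
  omega

/-- If `(c, d, q) = 1`, a common divisor of `q` and two of the linear forms divides their minor. -/
lemma natCast_dvd_minor (a b : Fin s → ℤ) (i j : Fin s) {c d q g : ℕ}
    (hcd : Nat.gcd (Nat.gcd c d) q = 1) (hq : g ∣ q) (hi : (g : ℤ) ∣ a i * c + b i * d)
    (hj : (g : ℤ) ∣ a j * c + b j * d) : (g : ℤ) ∣ minor a b i j := by
  have hc : (g : ℤ) ∣ minor a b i j * c := by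
    have : minor a b i j * c = b j * (a i * c + b i * d) - b i * (a j * c + b j * d) := by
      unfold minor; ring
    rw [this]
    exact dvd_sub (hi.mul_left _) (hj.mul_left _)
  have hd : (g : ℤ) ∣ minor a b i j * d := by
    have : minor a b i j * d = a i * (a j * c + b j * d) - a j * (a i * c + b i * d) := by
      unfold minor; ring
    rw [this]
    exact dvd_sub (hj.mul_left _) (hi.mul_left _)
  rw [Int.natCast_dvd] at hc hd ⊢
  rw [Int.natAbs_mul, Int.natAbs_natCast] at hc hd
  have h1 := Nat.dvd_gcd hc hd
  rw [Nat.gcd_mul_left] at h1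
  have h2 := Nat.dvd_gcd h1 (hq.mul_left (minor a b i j).natAbs)
  rwa [Nat.gcd_mul_left, hcd, mul_one] at h2

/-- Take i with the largest gcd. The gcds are powers of p, so each divides that of i, and hence
divides the corresponding minor. It is bounded when the minor is nonzero, and the minor vanishes for
at most six columns, i included. -/
lemma prod_gcd_le (a b : Fin s → ℤ) (hab : ∀ j, (a j, b j) ≠ (0, 0))
    (hs : 13 ≤ s) (hL : ∀ c d : ℤ, (c, d) ≠ (0, 0) →
      s - 6 ≤ (Finset.univ.filter (fun j : Fin s => c * a j + d * b j ≠ 0)).card)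
    {p : ℕ} (hp : p.Prime) (h : ℕ) {c d : ℕ} (hcd : Nat.gcd (Nat.gcd c d) (p ^ h) = 1) :
    ∃ i, ∏ j, Int.gcd (p ^ h : ℕ) (a j * c + b j * d) ≤
      minorBound a b ^ s * Int.gcd (p ^ h : ℕ) (a i * c + b i * d) ^ 6 := by
  have : Nonempty (Fin s) := ⟨⟨0, by omega⟩⟩
  set g : Fin s → ℕ := fun j => Int.gcd (p ^ h : ℕ) (a j * c + b j * d) with hg
  have hg1 : ∀ j, 1 ≤ g j := fun j =>
    Int.gcd_pos_of_ne_zero_left _ (by simp [hp.ne_zero])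
  have hD : 1 ≤ minorBound a b := by unfold minorBound; omega
  obtain ⟨i, hi⟩ := Finite.exists_max g
  refine ⟨i, ?_⟩
  have hdvd : ∀ j, g j ∣ g i := by
    intro j
    obtain ⟨k, _, hk⟩ := gcd_prime_pow_eq hp h (a j * c + b j * d)
    obtain ⟨l, _, hl⟩ := gcd_prime_pow_eq hp h (a i * c + b i * d)
    have h1 := hi j
    simp only [hg, hk, hl] at h1 ⊢
    exact pow_dvd_pow _ ((Nat.pow_le_pow_iff_right hp.one_lt).1 h1)
  have hsmall : ∀ j, minor a b i j ≠ 0 → g j ≤ minorBound a b := by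
    intro j hj
    have h1 : (g j : ℤ) ∣ minor a b i j := by
      refine natCast_dvd_minor a b i j hcd ?_ ?_ ?_
      · have : (g j : ℤ) ∣ (p ^ h : ℕ) := Int.gcd_dvd_left _ _
        exact_mod_cast this
      · exact (Int.natCast_dvd_natCast.2 (hdvd j)).trans (Int.gcd_dvd_right _ _)
      · exact Int.gcd_dvd_right _ _
    rw [Int.natCast_dvd] at h1
    exact (Nat.le_of_dvd (Int.natAbs_pos.2 hj) h1).trans (natAbs_minor_le a b i j)
  change ∏ j, g j ≤ minorBound a b ^ s * g i ^ 6
  rw [← Finset.prod_filter_mul_prod_filter_not Finset.univ (fun j => minor a b i j = 0), mul_comm]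
  refine Nat.mul_le_mul ?_ ?_
  · refine (Finset.prod_le_pow_card _ _ (minorBound a b) fun j hj =>
      hsmall j (Finset.mem_filter.1 hj).2).trans (Nat.pow_le_pow_right hD ?_)
    exact (Finset.card_le_univ _).trans (by simp)
  · exact (Finset.prod_le_pow_card _ _ (g i) fun j _ => hi j).trans
      (Nat.pow_le_pow_right (hg1 i) (card_minor_eq_zero_le a b hab hs hL i))

/-- The Gauss sum bound is cubic, so cubes are compared: q^(-3s) q^(2s) g^6 ≤ q^(-13) g^6. The
maximising index varies with (c, d), so its term is replaced by the sum over all j. -/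
lemma norm_U_le (a b : Fin s → ℤ) (hab : ∀ j, (a j, b j) ≠ (0, 0))
    (hs : 13 ≤ s) (hL : ∀ c d : ℤ, (c, d) ≠ (0, 0) →
      s - 6 ≤ (Finset.univ.filter (fun j : Fin s => c * a j + d * b j ≠ 0)).card)
    {p : ℕ} (hp : p.Prime) (h : ℕ) {c d : ℕ} (hcd : Nat.gcd (Nat.gcd c d) (p ^ h) = 1) :
    ‖U a b (p ^ h) c d‖ ≤ (64 * minorBound a b : ℝ) ^ s * ((p ^ h : ℕ) : ℝ) ^ (-(13 / 3) : ℝ) *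
      ∑ j, (Int.gcd (p ^ h : ℕ) (a j * c + b j * d) : ℝ) ^ 2 := by
  obtain ⟨i, hi⟩ := prod_gcd_le a b hab hs hL hp h hcd
  set q : ℕ := p ^ h with hq
  set D := minorBound a b with hDdef
  set g : Fin s → ℕ := fun j => Int.gcd q (a j * c + b j * d) with hg
  have hq1 : (1 : ℝ) ≤ q := by exact_mod_cast Nat.one_le_pow _ _ hp.pos
  have hq0 : (0 : ℝ) < q := by linarith
  have hD : (1 : ℝ) ≤ 64 * (D : ℝ) := by
    have : 1 ≤ D := by rw [hDdef]; unfold minorBound; omega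
    have : (1 : ℝ) ≤ D := by exact_mod_cast this
    linarith
  have h1 : ‖U a b q c d‖ ^ 3 ≤
      ((64 * D : ℝ) ^ s * (q : ℝ) ^ (-(13 / 3) : ℝ) * (g i : ℝ) ^ 2) ^ 3 := by
    have hqq : ((q : ℝ) ^ (-(13 / 3) : ℝ)) ^ 3 = ((q : ℝ) ^ 13)⁻¹ := by
      rw [← Real.rpow_natCast, ← Real.rpow_mul hq0.le, ← Real.rpow_natCast, ← Real.rpow_neg hq0.le]
      norm_num
    have hprod : (∏ j, (g j : ℝ)) ≤ (D : ℝ) ^ s * (g i : ℝ) ^ 6 := by exact_mod_cast hi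
    calc ‖U a b q c d‖ ^ 3
        = (((q : ℝ) ^ s)⁻¹) ^ 3 * ∏ j, ‖cubicGaussSum q (a j * c + b j * d)‖ ^ 3 := by
          rw [U, norm_mul, norm_inv, norm_pow, Complex.norm_natCast, norm_prod, mul_pow,
            Finset.prod_pow]
      _ ≤ (((q : ℝ) ^ s)⁻¹) ^ 3 * ∏ j, (64 * (q : ℝ) ^ 2 * g j) := by
          gcongr with j
          have := norm_cubicGaussSum_prime_pow_le hp h (a j * c + b j * d)
          rw [mul_comm 2 h, pow_mul, ← Nat.cast_pow] at this
          exact this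
      _ = (64 : ℝ) ^ s * ((q : ℝ) ^ s)⁻¹ * ∏ j, (g j : ℝ) := by
          rw [Finset.prod_mul_distrib, Finset.prod_const, Finset.card_univ, Fintype.card_fin,
            mul_pow, ← pow_mul, mul_comm 2 s, pow_mul]
          field_simp
      _ ≤ (64 : ℝ) ^ s * ((q : ℝ) ^ 13)⁻¹ * ((D : ℝ) ^ s * (g i : ℝ) ^ 6) := by
          gcongr
      _ = (64 * D : ℝ) ^ s * 1 * ((q : ℝ) ^ 13)⁻¹ * (g i : ℝ) ^ 6 := by rw [mul_pow]; ring
      -- The constant is enlarged only to become a perfect cube.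
      _ ≤ (64 * D : ℝ) ^ s * ((64 * D : ℝ) ^ s) ^ 2 * ((q : ℝ) ^ 13)⁻¹ * (g i : ℝ) ^ 6 := by
          gcongr
          exact one_le_pow₀ (one_le_pow₀ hD)
      _ = ((64 * D : ℝ) ^ s) ^ 3 * ((q : ℝ) ^ 13)⁻¹ * ((g i : ℝ) ^ 2) ^ 3 := by ring
      _ = _ := by rw [mul_pow _ ((g i : ℝ) ^ 2), mul_pow ((64 * D : ℝ) ^ s), hqq]
  have h2 : ‖U a b q c d‖ ≤ (64 * D : ℝ) ^ s * (q : ℝ) ^ (-(13 / 3) : ℝ) * (g i : ℝ) ^ 2 :=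
    le_of_pow_le_pow_left₀ three_ne_zero (by positivity) h1
  refine h2.trans (mul_le_mul_of_nonneg_left ?_ (by positivity))
  exact Finset.single_le_sum (f := fun j => (g j : ℝ) ^ 2) (fun _ _ => sq_nonneg _)
    (Finset.mem_univ i)

/-- The coefficients of the singular series at prime powers are `O((h + 1) p ^ (-4h/3))`. -/
theorem exists_abs_seriesFun_prime_pow_le (a b : Fin s → ℤ) (hab : ∀ j, (a j, b j) ≠ (0, 0))
    (hs : 13 ≤ s) (hL : ∀ c d : ℤ, (c, d) ≠ (0, 0) →
      s - 6 ≤ (Finset.univ.filter (fun j : Fin s => c * a j + d * b j ≠ 0)).card) :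
    ∃ K : ℝ, 0 ≤ K ∧ ∀ p : ℕ, p.Prime → ∀ h : ℕ,
      |seriesFun a b (p ^ h)| ≤ K * (h + 1) * ((p ^ h : ℕ) : ℝ) ^ (-(4 / 3) : ℝ) := by
  refine ⟨(64 * minorBound a b : ℝ) ^ s * ∑ j, (((a j).natAbs : ℝ) + ((b j).natAbs : ℝ)),
    by positivity, ?_⟩
  intro p hp h
  have hA : |seriesFun a b (p ^ h)| = ‖A a b (p ^ h)‖ := by
    rw [A_eq_seriesFun, Complex.norm_real, Real.norm_eq_abs]
  rw [hA]
  set q : ℕ := p ^ h with hq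
  have hq0 : (0 : ℝ) < q := by exact_mod_cast Nat.pow_pos hp.pos
  set E : ℝ := (64 * minorBound a b : ℝ) ^ s with hE
  have hE0 : 0 ≤ E := by positivity
  calc ‖A a b q‖ ≤ ∑ c ∈ Finset.Icc 1 q, ∑ d ∈ Finset.Icc 1 q, E * (q : ℝ) ^ (-(13 / 3) : ℝ) *
        ∑ j, (Int.gcd q (a j * c + b j * d) : ℝ) ^ 2 := by
        refine (norm_sum_le _ _).trans (Finset.sum_le_sum fun c _ => ?_)
        refine (norm_sum_le _ _).trans (Finset.sum_le_sum fun d _ => ?_)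
        split_ifs with hcd
        · exact norm_U_le a b hab hs hL hp h hcd
        · rw [norm_zero]
          positivity
    _ = E * (q : ℝ) ^ (-(13 / 3) : ℝ) * ∑ j, ∑ c ∈ Finset.Icc 1 q, ∑ d ∈ Finset.Icc 1 q,
          (Int.gcd q (a j * c + b j * d) : ℝ) ^ 2 := by
        simp_rw [← Finset.mul_sum]
        congr 1
        rw [Finset.sum_comm (s := Finset.univ)]
        refine Finset.sum_congr rfl fun c _ => ?_
        rw [Finset.sum_comm]
    _ ≤ E * (q : ℝ) ^ (-(13 / 3) : ℝ) *
          ∑ j, (((a j).natAbs : ℝ) + ((b j).natAbs : ℝ)) * (h + 1) * (q : ℝ) ^ 3 := by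
        gcongr with j
        exact_mod_cast sum_sum_gcd_sq_le hp h (a j) (b j) (hab j)
    _ = E * (∑ j, (((a j).natAbs : ℝ) + ((b j).natAbs : ℝ))) * (h + 1) *
          ((q : ℝ) ^ (-(13 / 3) : ℝ) * (q : ℝ) ^ 3) := by
        rw [← Finset.sum_mul, ← Finset.sum_mul]
        ring
    _ = _ := by
        rw [← Real.rpow_natCast, ← Real.rpow_add hq0]
        norm_num

end CubicPair

namespace CubicPair

/-! ### Convergence of the singular series -/

/-- A nonnegative multiplicative function is summable as soon as its values at prime powers are
dominated by a summable product bound. -/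
lemma summable_of_multiplicative {f : ℕ → ℝ} (hf : ∀ n, 0 ≤ f n) (hf0 : f 0 = 0) (hf1 : f 1 = 1)
    (hmul : ∀ {m n : ℕ}, m.Coprime n → f (m * n) = f m * f n) {v w : ℕ → ℝ} (hv0 : ∀ n, 0 ≤ v n)
    (hw : Summable w) (hv : Summable fun p : Nat.Primes => v p)
    (hb : ∀ p : ℕ, p.Prime → ∀ h, f (p ^ (h + 1)) ≤ v p * w h) : Summable f := by
  have hs1 : ∀ p : ℕ, p.Prime → Summable fun h => f (p ^ (h + 1)) := fun p hp =>
    Summable.of_nonneg_of_le (fun _ => hf _) (hb p hp) (hw.mul_left _)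
  have hs : ∀ {p : ℕ}, p.Prime → Summable fun h => ‖f (p ^ h)‖ := by
    intro p hp
    simp_rw [Real.norm_of_nonneg (hf _)]
    exact (summable_nat_add_iff 1).1 (hs1 p hp)
  have ht : ∀ p : ℕ, p.Prime → ∑' h, f (p ^ h) ≤ Real.exp (v p * |∑' h, w h|) := by
    intro p hp
    have h1 : Summable fun h => f (p ^ h) := (summable_nat_add_iff 1).1 (hs1 p hp)
    rw [h1.tsum_eq_zero_add, pow_zero, hf1]
    have h2 : ∑' h, f (p ^ (h + 1)) ≤ v p * ∑' h, w h := by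
      rw [← tsum_mul_left]
      exact (hs1 p hp).tsum_le_tsum (hb p hp) (hw.mul_left _)
    have h3 : v p * ∑' h, w h ≤ v p * |∑' h, w h| :=
      mul_le_mul_of_nonneg_left (le_abs_self _) (hv0 p)
    have h4 := Real.add_one_le_exp (v p * |∑' h, w h|)
    linarith
  refine summable_of_sum_le (c := Real.exp ((∑' p : Nat.Primes, v p) * |∑' h, w h|)) hf fun u => ?_
  -- Every nonzero element of u is below N, hence N-smooth, and the sum of f over N-smooth numbers
  -- is a finite Euler product with factors at most exp(v_p |∑ w|).
  set N := u.sup id + 1 with hN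
  obtain ⟨-, h2⟩ := EulerProduct.summable_and_hasSum_smoothNumbers_prod_primesBelow_tsum hf1 hmul hs N
  have h3 := hasSum_subtype_iff_indicator.1 h2
  calc ∑ x ∈ u, f x = ∑ x ∈ u, (Nat.smoothNumbers N).indicator f x := by
        refine Finset.sum_congr rfl fun x hx => ?_
        rcases eq_or_ne x 0 with rfl | hx0
        · rw [hf0]
          symm
          rw [Set.indicator_apply_eq_zero]
          exact fun _ => hf0
        · rw [Set.indicator_of_mem]
          refine Nat.mem_smoothNumbers_of_lt (Nat.pos_of_ne_zero hx0) ?_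
          exact Nat.lt_succ_of_le (Finset.le_sup (f := id) hx)
    _ ≤ ∏ p ∈ N.primesBelow, ∑' h, f (p ^ h) :=
        sum_le_hasSum u (fun x _ => Set.indicator_nonneg (fun _ _ => hf _) x) h3
    _ ≤ ∏ p ∈ N.primesBelow, Real.exp (v p * |∑' h, w h|) :=
        Finset.prod_le_prod (fun p _ => tsum_nonneg fun _ => hf _)
          fun p hp => ht p (Nat.prime_of_mem_primesBelow hp)
    _ = Real.exp ((∑ p ∈ N.primesBelow, v p) * |∑' h, w h|) := by
        rw [← Real.exp_sum, Finset.sum_mul]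
    _ ≤ _ := by
        refine Real.exp_le_exp.2 (mul_le_mul_of_nonneg_right ?_ (abs_nonneg _))
        have h5 : ∑ p ∈ N.primesBelow, v p =
            ∑ p ∈ N.primesBelow.subtype Nat.Prime, v (p : ℕ) := by
          rw [Finset.sum_subtype_of_mem (f := v)]
          exact fun p hp => Nat.prime_of_mem_primesBelow hp
        rw [h5]
        exact hv.sum_le_tsum (ι := Nat.Primes) (N.primesBelow.subtype Nat.Prime) (fun p _ => hv0 p)

lemma summable_add_two_mul_half_pow : Summable fun h : ℕ => ((h : ℝ) + 2) * (1 / 2 : ℝ) ^ h := by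
  have h1 : Summable fun h : ℕ => (h : ℝ) ^ 1 * (1 / 2 : ℝ) ^ h :=
    summable_pow_mul_geometric_of_norm_lt_one 1 (by norm_num)
  have h2 : Summable fun h : ℕ => (2 : ℝ) * (1 / 2 : ℝ) ^ h :=
    (summable_geometric_of_lt_one (by norm_num) (by norm_num)).mul_left 2
  refine (h1.add h2).congr fun h => ?_
  ring

variable {s : ℕ}

/-- The coefficients of the singular series weighted by `n ^ (1 / 4)`. -/
noncomputable def weighted (a b : Fin s → ℤ) (n : ℕ) : ℝ :=
  |seriesFun a b n| * (n : ℝ) ^ (1 / 4 : ℝ)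

lemma weighted_nonneg (a b : Fin s → ℤ) (n : ℕ) : 0 ≤ weighted a b n := by
  unfold weighted; positivity

lemma abs_seriesFun_le_weighted (a b : Fin s → ℤ) (n : ℕ) :
    |seriesFun a b n| ≤ weighted a b n := by
  rcases Nat.eq_zero_or_pos n with rfl | hn
  · simp [weighted]
  · exact le_mul_of_one_le_right (abs_nonneg _)
      (Real.one_le_rpow (by exact_mod_cast hn) (by norm_num))

/-- Here -4/3 + 1/4 = -13/12 < -1. One factor p^(-13/12) is kept for the sum over primes; the others
are at most 1/2 and make the sum over h converge uniformly in p. -/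
lemma exists_weighted_prime_pow_le (a b : Fin s → ℤ) (hab : ∀ j, (a j, b j) ≠ (0, 0))
    (hs : 13 ≤ s) (hL : ∀ c d : ℤ, (c, d) ≠ (0, 0) →
      s - 6 ≤ (Finset.univ.filter (fun j : Fin s => c * a j + d * b j ≠ 0)).card) :
    ∃ K : ℝ, 0 ≤ K ∧ ∀ p : ℕ, p.Prime → ∀ h : ℕ,
      weighted a b (p ^ (h + 1)) ≤
        K * (p : ℝ) ^ (-(13 / 12) : ℝ) * (((h : ℝ) + 2) * (1 / 2 : ℝ) ^ h) := by
  obtain ⟨K, hK, hb⟩ := exists_abs_seriesFun_prime_pow_le a b hab hs hL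
  refine ⟨K, hK, fun p hp h => ?_⟩
  have hp0 : (0 : ℝ) < p := by exact_mod_cast hp.pos
  have hp2 : (2 : ℝ) ≤ p := by exact_mod_cast hp.two_le
  have hq0 : (0 : ℝ) < ((p ^ (h + 1) : ℕ) : ℝ) := by exact_mod_cast Nat.pow_pos hp.pos
  set x : ℝ := (p : ℝ) ^ (-(13 / 12) : ℝ) with hx
  have hx0 : 0 ≤ x := by positivity
  have hx1 : x ≤ 1 / 2 := by
    calc x ≤ (p : ℝ) ^ (-1 : ℝ) :=
          Real.rpow_le_rpow_of_exponent_le (by linarith) (by norm_num)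
      _ = (p : ℝ)⁻¹ := Real.rpow_neg_one _
      _ ≤ (2 : ℝ)⁻¹ := by gcongr
      _ = 1 / 2 := by norm_num
  calc weighted a b (p ^ (h + 1))
      ≤ (K * ((h + 1 : ℕ) + 1) * ((p ^ (h + 1) : ℕ) : ℝ) ^ (-(4 / 3) : ℝ)) *
          ((p ^ (h + 1) : ℕ) : ℝ) ^ (1 / 4 : ℝ) :=
        mul_le_mul_of_nonneg_right (hb p hp (h + 1)) (by positivity)
    _ = K * (h + 2) * ((p ^ (h + 1) : ℕ) : ℝ) ^ (-(13 / 12) : ℝ) := by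
        rw [mul_assoc, ← Real.rpow_add hq0]
        push_cast
        norm_num
        ring_nf
        simp
    _ = K * (h + 2) * (x * x ^ h) := by
        rw [Nat.cast_pow, ← Real.rpow_natCast, ← Real.rpow_mul hp0.le, mul_comm ((h + 1 : ℕ) : ℝ),
          Real.rpow_mul hp0.le, Real.rpow_natCast, pow_succ']
    _ ≤ K * (h + 2) * (x * (1 / 2) ^ h) := by gcongr
    _ = _ := by ring

lemma summable_primes_rpow (K : ℝ) :
    Summable fun p : Nat.Primes => K * ((p : ℕ) : ℝ) ^ (-(13 / 12) : ℝ) :=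
  (Nat.Primes.summable_rpow.2 (by norm_num)).mul_left K

/-- The weight n^(1/4) preserves multiplicativity, so the prime power bounds suffice. The tail
estimate and the Euler product both rest on this. -/
theorem summable_weighted (a b : Fin s → ℤ) (hab : ∀ j, (a j, b j) ≠ (0, 0))
    (hs : 13 ≤ s) (hL : ∀ c d : ℤ, (c, d) ≠ (0, 0) →
      s - 6 ≤ (Finset.univ.filter (fun j : Fin s => c * a j + d * b j ≠ 0)).card) :
    Summable (weighted a b) := by
  obtain ⟨K, hK, hb⟩ := exists_weighted_prime_pow_le a b hab hs hL
  have hmult := seriesFun_isMultiplicative a b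
  refine summable_of_multiplicative (weighted_nonneg a b) (by simp [weighted])
    (by simp [weighted, hmult.map_one]) ?_ (v := fun p => K * (p : ℝ) ^ (-(13 / 12) : ℝ))
    (fun n => by positivity) summable_add_two_mul_half_pow (summable_primes_rpow K) hb
  intro m n hmn
  unfold weighted
  rw [hmult.map_mul_of_coprime hmn, abs_mul, Nat.cast_mul,
    Real.mul_rpow (Nat.cast_nonneg _) (Nat.cast_nonneg _)]
  ring

/-- The singular series. -/
noncomputable def singularSeries (a b : Fin s → ℤ) : ℝ := ∑' n, seriesFun a b n

/-- The local densities. -/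
noncomputable def localDensity (a b : Fin s → ℤ) (p : ℕ) : ℝ := ∑' h, seriesFun a b (p ^ h)

lemma summable_seriesFun {a b : Fin s → ℤ} (h : Summable (weighted a b)) :
    Summable fun n => ‖seriesFun a b n‖ :=
  Summable.of_nonneg_of_le (fun _ => norm_nonneg _) (abs_seriesFun_le_weighted a b) h

lemma truncatedSingularSeries_eq (a b : Fin s → ℤ) (X : ℝ) :
    truncatedSingularSeries a b X =
      ((∑ q ∈ Finset.Icc 1 ⌊X⌋₊, seriesFun a b q : ℝ) : ℂ) := by
  unfold truncatedSingularSeries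
  push_cast
  exact Finset.sum_congr rfl fun q _ => A_eq_seriesFun a b q

/-- For n > X one has 1 ≤ (n/X)^(1/4), so the tail is at most X^(-1/4) times the full weighted sum.
-/
lemma norm_singularSeries_sub_le {a b : Fin s → ℤ} (hsum : Summable (weighted a b)) {X : ℝ}
    (hX : 0 < X) :
    ‖(singularSeries a b : ℂ) - truncatedSingularSeries a b X‖ ≤
      (∑' n, weighted a b n) * X ^ (-(1 / 4) : ℝ) := by
  have hs := (summable_seriesFun hsum).of_norm
  rw [truncatedSingularSeries_eq, ← Complex.ofReal_sub, Complex.norm_real, singularSeries,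
    ← hs.sum_add_tsum_compl (s := Finset.Icc 1 ⌊X⌋₊), add_sub_cancel_left]
  have hsub : Summable fun n : ↥((Finset.Icc 1 ⌊X⌋₊ : Finset ℕ) : Set ℕ)ᶜ =>
      weighted a b n * X ^ (-(1 / 4) : ℝ) := (hsum.mul_right _).subtype _
  refine (tsum_of_norm_bounded hsub.hasSum ?_).trans ?_
  · rintro ⟨n, hn⟩
    rw [Real.norm_eq_abs]
    rcases Nat.eq_zero_or_pos n with rfl | hn0
    -- The index 0 also lies outside the truncated range; its term is 0.
    · simp [weighted]
    · have hn1 : ⌊X⌋₊ < n := by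
        by_contra hc
        exact hn (by simp; omega)
      have hXn : X ≤ n := (Nat.lt_of_floor_lt hn1).le
      have h1 : X ^ (1 / 4 : ℝ) ≤ (n : ℝ) ^ (1 / 4 : ℝ) :=
        Real.rpow_le_rpow hX.le hXn (by norm_num)
      rw [weighted, mul_assoc, Real.rpow_neg hX.le]
      refine le_mul_of_one_le_right (abs_nonneg _) ?_
      rw [← div_eq_mul_inv, one_le_div (by positivity)]
      exact h1
  · rw [tsum_mul_right]
    refine mul_le_mul_of_nonneg_right ?_ (by positivity)
    exact Summable.tsum_subtype_le _ _ (weighted_nonneg a b) hsum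

lemma tendsto_truncatedSingularSeries {a b : Fin s → ℤ} (hsum : Summable (weighted a b)) :
    Tendsto (fun X : ℝ => truncatedSingularSeries a b X) atTop
      (𝓝 (singularSeries a b : ℂ)) := by
  rw [tendsto_iff_norm_sub_tendsto_zero]
  have h1 : Tendsto (fun X : ℝ => (∑' n, weighted a b n) * X ^ (-(1 / 4) : ℝ)) atTop (𝓝 0) := by
    simpa using (tendsto_rpow_neg_atTop (by norm_num : (0 : ℝ) < 1 / 4)).const_mul
      (∑' n, weighted a b n)
  refine squeeze_zero' (Eventually.of_forall fun _ => norm_nonneg _) ?_ h1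
  filter_upwards [eventually_gt_atTop 0] with X hX
  rw [norm_sub_rev]
  exact norm_singularSeries_sub_le hsum hX

lemma summable_seriesFun_prime_pow {a b : Fin s → ℤ} (hsum : Summable (weighted a b)) {p : ℕ}
    (hp : p.Prime) : Summable fun h => seriesFun a b (p ^ h) :=
  (summable_seriesFun hsum).of_norm.comp_injective (Nat.pow_right_injective hp.two_le)

lemma tendsto_normalizedCount {a b : Fin s → ℤ} (hsum : Summable (weighted a b)) {p : ℕ}
    (hp : p.Prime) :
    Tendsto (fun h : ℕ => normalizedCount a b p h) atTop (𝓝 (localDensity a b p)) := by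
  simp_rw [normalizedCount_eq_density, density_prime_pow a b hp]
  exact (summable_seriesFun_prime_pow hsum hp).hasSum.tendsto_sum_nat.comp (tendsto_add_atTop_nat 1)

lemma hasProd_localDensity {a b : Fin s → ℤ} (hsum : Summable (weighted a b)) :
    HasProd (fun p : Nat.Primes => localDensity a b p) (singularSeries a b) :=
  EulerProduct.eulerProduct_hasProd (seriesFun_isMultiplicative a b).map_one
    (fun h => (seriesFun_isMultiplicative a b).map_mul_of_coprime h) (summable_seriesFun hsum)
    ArithmeticFunction.map_zero

lemma summable_abs_localDensity_sub_one (a b : Fin s → ℤ) (hab : ∀ j, (a j, b j) ≠ (0, 0))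
    (hs : 13 ≤ s) (hL : ∀ c d : ℤ, (c, d) ≠ (0, 0) →
      s - 6 ≤ (Finset.univ.filter (fun j : Fin s => c * a j + d * b j ≠ 0)).card) :
    Summable fun p : Nat.Primes => |localDensity a b p - 1| := by
  obtain ⟨K, hK, hb⟩ := exists_weighted_prime_pow_le a b hab hs hL
  have hsum := summable_weighted a b hab hs hL
  refine Summable.of_nonneg_of_le (fun _ => abs_nonneg _) (fun p => ?_)
    ((summable_primes_rpow K).mul_right (∑' h : ℕ, ((h : ℝ) + 2) * (1 / 2 : ℝ) ^ h))
  rw [localDensity, (summable_seriesFun_prime_pow hsum p.2).tsum_eq_zero_add, pow_zero,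
    (seriesFun_isMultiplicative a b).map_one, add_sub_cancel_left, ← tsum_mul_left,
    ← Real.norm_eq_abs]
  exact tsum_of_norm_bounded (summable_add_two_mul_half_pow.mul_left _).hasSum
    fun h => (abs_seriesFun_le_weighted a b _).trans (hb p p.2 h)

/-- Positivity of the factors alone would not prevent the product from vanishing; summability of
|χ_p - 1| makes the logarithms summable. -/
lemma singularSeries_pos {a b : Fin s → ℤ} (hsum : Summable (weighted a b))
    (habs : Summable fun p : Nat.Primes => |localDensity a b p - 1|)
    (hpos : ∀ p : Nat.Primes, 0 < localDensity a b p) : 0 < singularSeries a b := by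
  have h1 : Summable fun p : Nat.Primes => Real.log (localDensity a b p) := by
    have := Real.summable_log_one_add_of_summable habs.of_abs
    simpa using this
  rw [← (hasProd_localDensity hsum).tprod_eq, ← Real.rexp_tsum_eq_tprod hpos h1]
  exact Real.exp_pos _

end CubicPair

namespace CubicPair

/-! ### Local obstructions -/

variable {s : ℕ}

lemma IsSolution.map {a b : Fin s → ℤ} {R S : Type*} [CommRing R] [CommRing S] (f : R →+* S)
    {x : Fin s → R} (hx : IsSolution a b x) : IsSolution a b fun j => f (x j) := by
  constructor
  · simpa using congrArg f hx.1
  · simpa using congrArg f hx.2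

lemma isSolution_natCast_iff (a b : Fin s → ℤ) (n : ℕ) (v : Fin s → ℕ) :
    IsSolution a b (fun j => (v j : ZMod n)) ↔
      (n : ℤ) ∣ ∑ j, a j * (v j : ℤ) ^ 3 ∧ (n : ℤ) ∣ ∑ j, b j * (v j : ℤ) ^ 3 := by
  unfold IsSolution
  rw [← ZMod.intCast_zmod_eq_zero_iff_dvd, ← ZMod.intCast_zmod_eq_zero_iff_dvd]
  push_cast
  rfl

/-- If all solutions modulo `p ^ (k + 3)` are divisible by `p`, they come from solutions modulo
`p ^ k`. -/
lemma solutionCount_add_three_le (a b : Fin s → ℤ) {p : ℕ} (hp : p.Prime) (k : ℕ)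
    (hdiv : ∀ x : Fin s → ZMod (p ^ (k + 3)), IsSolution a b x → ∀ j, p ∣ (x j).val) :
    solutionCount a b (p ^ (k + 3)) ≤ solutionCount a b (p ^ k) * (p ^ 2) ^ s := by
  have : NeZero p := ⟨hp.ne_zero⟩
  have hpk : 0 < p ^ k := pow_pos hp.pos _
  have hcard : Nat.card (Fin s → Fin (p ^ 2)) = (p ^ 2) ^ s := by simp
  unfold solutionCount
  rw [← hcard, ← Nat.card_prod]
  have key : ∀ f : Fin s → ℤ, ∀ x : Fin s → ℕ, (∀ j, p ∣ x j) →
      ((p ^ (k + 3) : ℕ) : ℤ) ∣ ∑ j, f j * (x j : ℤ) ^ 3 →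
      ((p ^ k : ℕ) : ℤ) ∣ ∑ j, f j * ((x j / p : ℕ) : ℤ) ^ 3 := by
    intro f x hx h
    have h1 : ∑ j, f j * (x j : ℤ) ^ 3 =
        (∑ j, f j * ((x j / p : ℕ) : ℤ) ^ 3) * ((p ^ 3 : ℕ) : ℤ) := by
      rw [Finset.sum_mul]
      refine Finset.sum_congr rfl fun j _ => ?_
      conv_lhs => rw [← Nat.div_mul_cancel (hx j)]
      push_cast
      ring
    rw [h1, pow_add, Nat.cast_mul] at h
    exact (mul_dvd_mul_iff_right (by exact_mod_cast pow_ne_zero 3 hp.ne_zero)).1 h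
  have hlift : ∀ x : Fin s → ZMod (p ^ (k + 3)), IsSolution a b x →
      IsSolution a b (fun j => (((x j).val / p : ℕ) : ZMod (p ^ k))) := by
    intro x hx
    have h1 : IsSolution a b (fun j => (((x j).val : ℕ) : ZMod (p ^ (k + 3)))) := by
      simpa using hx
    rw [isSolution_natCast_iff] at h1 ⊢
    exact ⟨key a _ (hdiv x hx) h1.1, key b _ (hdiv x hx) h1.2⟩
  have hlt : ∀ x : ZMod (p ^ (k + 3)), x.val / p / p ^ k < p ^ 2 := by
    intro x
    rw [Nat.div_div_eq_div_mul]
    apply Nat.div_lt_of_lt_mul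
    have h1 := ZMod.val_lt x
    calc x.val < p ^ (k + 3) := h1
      _ = p * p ^ k * p ^ 2 := by ring
  -- As p ∣ x_j, the coordinate is recovered from x_j / p < p^(k+2), that is, from its residue
  -- modulo p^k and a quotient below p^2.
  refine Nat.card_le_card_of_injective
    (fun x : {x : Fin s → ZMod (p ^ (k + 3)) // IsSolution a b x} =>
      ((⟨_, hlift x.1 x.2⟩ : {x : Fin s → ZMod (p ^ k) // IsSolution a b x}),
        fun j => (⟨(x.1 j).val / p / p ^ k, hlt _⟩ : Fin (p ^ 2)))) ?_
  rintro ⟨x, hx⟩ ⟨y, hy⟩ h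
  rw [Prod.mk.injEq, Subtype.mk.injEq] at h
  ext j
  have h1 := congrFun h.1 j
  have h2 := congrArg Fin.val (congrFun h.2 j)
  simp only at h1 h2 ⊢
  have h3 : (x j).val / p % p ^ k = (y j).val / p % p ^ k :=
    (ZMod.natCast_eq_natCast_iff' _ _ _).1 h1
  apply ZMod.val_injective
  rw [← Nat.div_mul_cancel (hdiv x hx j), ← Nat.div_mul_cancel (hdiv y hy j),
    ← Nat.div_add_mod ((x j).val / p) (p ^ k), ← Nat.div_add_mod ((y j).val / p) (p ^ k), h2, h3]

lemma normalizedCount_nonneg (a b : Fin s → ℤ) (p h : ℕ) : 0 ≤ normalizedCount a b p h := by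
  unfold normalizedCount; positivity

/-- The normalisation contributes p^(3(2-s)) and the count p^(2s); together p^(6-s) ≤ 1/p ≤ 1/2. -/
lemma normalizedCount_add_three_le (a b : Fin s → ℤ) (hs : 7 ≤ s) {p : ℕ} (hp : p.Prime) (k : ℕ)
    (h : solutionCount a b (p ^ (k + 3)) ≤ solutionCount a b (p ^ k) * (p ^ 2) ^ s) :
    normalizedCount a b p (k + 3) ≤ 1 / 2 * normalizedCount a b p k := by
  have hp0 : (0 : ℝ) < p := by exact_mod_cast hp.pos
  have hp2 : (2 : ℝ) ≤ p := by exact_mod_cast hp.two_le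
  have h' : (solutionCount a b (p ^ (k + 3)) : ℝ) ≤
      solutionCount a b (p ^ k) * (p : ℝ) ^ (2 * (s : ℤ)) := by
    have : (solutionCount a b (p ^ (k + 3)) : ℝ) ≤
      solutionCount a b (p ^ k) * ((p : ℝ) ^ 2) ^ s := by exact_mod_cast h
    rwa [zpow_mul, zpow_natCast, zpow_ofNat]
  unfold normalizedCount
  calc (p : ℝ) ^ (((k + 3 : ℕ) : ℤ) * (2 - (s : ℤ))) * (solutionCount a b (p ^ (k + 3)) : ℝ)
      ≤ (p : ℝ) ^ (((k + 3 : ℕ) : ℤ) * (2 - (s : ℤ))) *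
          (solutionCount a b (p ^ k) * (p : ℝ) ^ (2 * (s : ℤ))) := by gcongr
    _ = (p : ℝ) ^ (6 - (s : ℤ)) *
          ((p : ℝ) ^ ((k : ℤ) * (2 - (s : ℤ))) * (solutionCount a b (p ^ k) : ℝ)) := by
        have e : (p : ℝ) ^ (((k + 3 : ℕ) : ℤ) * (2 - (s : ℤ))) * (p : ℝ) ^ (2 * (s : ℤ)) =
            (p : ℝ) ^ (6 - (s : ℤ)) * (p : ℝ) ^ ((k : ℤ) * (2 - (s : ℤ))) := by
          rw [← zpow_add₀ hp0.ne', ← zpow_add₀ hp0.ne']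
          congr 1
          push_cast
          ring
        linear_combination (solutionCount a b (p ^ k) : ℝ) * e
    _ ≤ _ := by
        gcongr
        calc (p : ℝ) ^ (6 - (s : ℤ)) ≤ (p : ℝ) ^ (-1 : ℤ) :=
              zpow_le_zpow_right₀ (by linarith) (by omega)
          _ = (p : ℝ)⁻¹ := zpow_neg_one _
          _ ≤ (2 : ℝ)⁻¹ := by gcongr
          _ = 1 / 2 := by norm_num

/-- Without primitive `p`-adic solutions, the solutions modulo high powers of `p` are all divisible
by `p`. -/
lemma exists_dvd_of_no_solution (a b : Fin s → ℤ) (p : ℕ) [Fact p.Prime]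
    (hno : ¬ HasNontrivialSolution a b ℚ_[p]) :
    ∃ h₀ : ℕ, ∀ h, h₀ ≤ h → ∀ x : Fin s → ZMod (p ^ h), IsSolution a b x → ∀ j, p ∣ (x j).val := by
  have hp : p.Prime := Fact.out
  set φ : (Fin s → ℤ_[p]) → ℝ := fun x =>
    ‖∑ j, (a j : ℤ_[p]) * x j ^ 3‖ + ‖∑ j, (b j : ℤ_[p]) * x j ^ 3‖ with hφ
  have hcont : Continuous φ := by fun_prop
  have hpos : ∀ x : Fin s → ℤ_[p], x ≠ 0 → 0 < φ x := by
    intro x hx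
    by_contra hc
    have h1 : ‖∑ j, (a j : ℤ_[p]) * x j ^ 3‖ = 0 := by
      have := norm_nonneg (∑ j, (a j : ℤ_[p]) * x j ^ 3)
      have := norm_nonneg (∑ j, (b j : ℤ_[p]) * x j ^ 3)
      simp only [hφ] at hc
      linarith
    have h2 : ‖∑ j, (b j : ℤ_[p]) * x j ^ 3‖ = 0 := by
      have := norm_nonneg (∑ j, (b j : ℤ_[p]) * x j ^ 3)
      simp only [hφ] at hc
      linarith
    rw [norm_eq_zero] at h1 h2
    refine hno ⟨fun j => (x j : ℚ_[p]), ?_, IsSolution.map PadicInt.Coe.ringHom ⟨h1, h2⟩⟩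
    intro h
    apply hx
    ext j
    simpa using congrFun h j
  -- The vectors of sup norm 1 are the primitive ones. They form a compact set on which φ has no
  -- zero, so φ is bounded below there.
  have hε : ∃ ε : ℝ, 0 < ε ∧ ∀ x : Fin s → ℤ_[p], ‖x‖ = 1 → ε ≤ φ x := by
    have hK : IsCompact (Metric.sphere (0 : Fin s → ℤ_[p]) 1) := Metric.isClosed_sphere.isCompact
    rcases (Metric.sphere (0 : Fin s → ℤ_[p]) 1).eq_empty_or_nonempty with he | hne
    · refine ⟨1, one_pos, fun x hx => ?_⟩
      have : x ∈ Metric.sphere (0 : Fin s → ℤ_[p]) 1 := by simpa using hx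
      rw [he] at this
      exact this.elim
    · obtain ⟨y, hy, hmin⟩ := hK.exists_isMinOn hne hcont.continuousOn
      refine ⟨φ y, hpos y ?_, fun x hx => hmin (by simpa using hx)⟩
      rintro rfl
      simp at hy
  obtain ⟨ε, hε0, hε⟩ := hε
  have hp1 : (1 : ℝ) < p := by exact_mod_cast hp.one_lt
  -- Once p^(-h) < ε/2, an integral lift of a solution modulo p^h has φ < ε and so cannot be
  -- primitive.
  obtain ⟨h₀, hh₀⟩ := exists_pow_lt_of_lt_one (half_pos hε0) (inv_lt_one_of_one_lt₀ hp1)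
  refine ⟨h₀, fun h hh x hx => ?_⟩
  have : NeZero p := ⟨hp.ne_zero⟩
  set X : Fin s → ℤ_[p] := fun j => (((x j).val : ℕ) : ℤ_[p]) with hX
  have hsmall : ∀ f : Fin s → ℤ, ∑ j, (f j : ZMod (p ^ h)) * x j ^ 3 = 0 →
      ‖∑ j, (f j : ℤ_[p]) * X j ^ 3‖ < ε / 2 := by
    intro f hf
    have h1 : ∑ j, (f j : ℤ_[p]) * X j ^ 3 ∈ RingHom.ker (PadicInt.toZModPow (p := p) h) := by
      rw [RingHom.mem_ker, map_sum, ← hf]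
      refine Finset.sum_congr rfl fun j _ => ?_
      simp [hX]
    rw [PadicInt.ker_toZModPow, ← PadicInt.norm_le_pow_iff_mem_span_pow] at h1
    refine h1.trans_lt (lt_of_le_of_lt ?_ hh₀)
    rw [zpow_neg, zpow_natCast, ← inv_pow]
    exact pow_le_pow_of_le_one (by positivity) (inv_le_one_of_one_le₀ hp1.le) hh
  have hXlt : ‖X‖ < 1 := by
    have h1 : ‖X‖ ≤ 1 := (pi_norm_le_iff_of_nonneg zero_le_one).2 fun j => PadicInt.norm_le_one _
    refine lt_of_le_of_ne h1 fun h2 => ?_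
    have h3 := hε X h2
    have h4 := hsmall a hx.1
    have h5 := hsmall b hx.2
    simp only [hφ] at h3
    linarith
  intro j
  have h1 : ‖(((x j).val : ℤ) : ℤ_[p])‖ < 1 := by
    have := (norm_le_pi_norm X j).trans_lt hXlt
    simpa [hX] using this
  rw [PadicInt.norm_int_lt_one_iff_dvd] at h1
  exact_mod_cast h1

/-- The limit ℓ of the normalised counts satisfies 0 ≤ ℓ ≤ ℓ/2. -/
theorem localDensity_eq_zero {a b : Fin s → ℤ} (hs : 7 ≤ s) (hsum : Summable (weighted a b))
    (p : ℕ) [Fact p.Prime] (hno : ¬ HasNontrivialSolution a b ℚ_[p]) :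
    localDensity a b p = 0 := by
  have hp : p.Prime := Fact.out
  obtain ⟨h₀, hh₀⟩ := exists_dvd_of_no_solution a b p hno
  have hlim := tendsto_normalizedCount hsum hp
  have h1 : localDensity a b p ≤ 1 / 2 * localDensity a b p := by
    refine le_of_tendsto_of_tendsto (hlim.comp (tendsto_add_atTop_nat 3)) (hlim.const_mul (1 / 2)) ?_
    filter_upwards [eventually_ge_atTop h₀] with k hk
    exact normalizedCount_add_three_le a b hs hp k
      (solutionCount_add_three_le a b hp k (hh₀ (k + 3) (by omega)))
  have h2 : 0 ≤ localDensity a b p :=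
    ge_of_tendsto' hlim fun h => normalizedCount_nonneg a b p h
  linarith

end CubicPair

namespace CubicPair

/-! ### Diagonal cubic forms over finite fields and over the `p`-adic numbers -/

section FiniteField

variable {F : Type*} [Field F] [Fintype F] [DecidableEq F]

/-- The coset of `x` modulo nonzero cubes. -/
def cubeCoset (x : F) : Finset F := (Finset.univ.erase (0 : F)).image fun t => x * t ^ 3

lemma mem_cubeCoset {x y : F} : y ∈ cubeCoset x ↔ ∃ t, t ≠ 0 ∧ x * t ^ 3 = y := by
  simp [cubeCoset]

lemma self_mem_cubeCoset (x : F) : x ∈ cubeCoset x := mem_cubeCoset.2 ⟨1, one_ne_zero, by simp⟩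

lemma zero_notMem_cubeCoset {x : F} (hx : x ≠ 0) : (0 : F) ∉ cubeCoset x := by
  rw [mem_cubeCoset]
  rintro ⟨t, ht, h⟩
  exact mul_ne_zero hx (pow_ne_zero 3 ht) h

lemma cubeCoset_symm {x y : F} (h : y ∈ cubeCoset x) : x ∈ cubeCoset y := by
  obtain ⟨t, ht, rfl⟩ := mem_cubeCoset.1 h
  refine mem_cubeCoset.2 ⟨t⁻¹, inv_ne_zero ht, ?_⟩
  field_simp

lemma cubeCoset_trans {x y z : F} (h : y ∈ cubeCoset x) (h' : z ∈ cubeCoset y) :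
    z ∈ cubeCoset x := by
  obtain ⟨t, ht, rfl⟩ := mem_cubeCoset.1 h
  obtain ⟨u, hu, rfl⟩ := mem_cubeCoset.1 h'
  exact mem_cubeCoset.2 ⟨t * u, mul_ne_zero ht hu, by ring⟩

lemma card_cubeCoset {x : F} (hx : x ≠ 0) : (cubeCoset x).card = (cubeCoset (1 : F)).card := by
  have : cubeCoset x = (cubeCoset (1 : F)).image (x * ·) := by
    simp [cubeCoset, Finset.image_image, Function.comp_def]
  rw [this, Finset.card_image_of_injective _ (mul_right_injective₀ hx)]

/-- Cubing is at most 3-to-1, so the nonzero elements split into at most three cosets of cubes. -/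
lemma card_erase_zero_le : (Finset.univ.erase (0 : F)).card ≤ 3 * (cubeCoset (1 : F)).card := by
  refine Finset.card_le_mul_card_image _ 3 fun y _ => ?_
  refine (Finset.card_le_card (t := Finset.univ.filter fun x : F => x ^ 3 = y) ?_).trans
    (card_cube_eq_le y)
  intro t ht
  simp only [Finset.mem_filter, Finset.mem_univ, true_and, one_mul] at ht ⊢
  exact ht.2

/-- A diagonal cubic form in three variables over a finite field is isotropic. -/
theorem exists_diagonal_cubic_zero (k : Fin 3 → F) (hk : ∀ i, k i ≠ 0) :
    ∃ v : Fin 3 → F, v ≠ 0 ∧ ∑ i, k i * v i ^ 3 = 0 := by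
  -- Without a zero the three coefficients lie in distinct cosets of cubes, which then partition the
  -- nonzero elements. A sum x + y with x, y in different cosets cannot fall in the third, so it
  -- lies in the coset of x or of y. With n the coset size, there are 3n · 2n such pairs, but at
  -- most 2 · 3n(n - 1) can satisfy this.
  by_contra! hno
  set n := (cubeCoset (1 : F)).card with hn
  set E := Finset.univ.erase (0 : F) with hE
  have hsub : ∀ x : F, x ≠ 0 → cubeCoset x ⊆ E := fun x hx y hy =>
    Finset.mem_erase.2 ⟨fun h => zero_notMem_cubeCoset hx (h ▸ hy), Finset.mem_univ _⟩
  have hdisj : ∀ i j, i ≠ j → k j ∉ cubeCoset (k i) := by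
    intro i j hij h
    obtain ⟨t, ht, h⟩ := mem_cubeCoset.1 h
    refine hno (Pi.single i t - Pi.single j 1) ?_ ?_
    · intro h0
      have := congrFun h0 j
      simp [hij.symm] at this
    · rw [← Finset.sum_subset (Finset.subset_univ {i, j}), Finset.sum_pair hij]
      · simp [hij, hij.symm]
        rw [h]
        ring
      · intro l _ hl
        simp only [Finset.mem_insert, Finset.mem_singleton, not_or] at hl
        simp [hl.1, hl.2]
  have hunion : (Finset.univ.biUnion fun i => cubeCoset (k i)).card = 3 * n := by
    rw [Finset.card_biUnion]
    · simp [card_cubeCoset (hk _), hn]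
    · intro i _ j _ hij
      rw [Function.onFun, Finset.disjoint_left]
      intro x hx hx'
      exact hdisj i j hij (cubeCoset_trans hx (cubeCoset_symm hx'))
  have hsubE : (Finset.univ.biUnion fun i => cubeCoset (k i)) ⊆ E :=
    Finset.biUnion_subset.2 fun i _ => hsub _ (hk i)
  have hEeq : (Finset.univ.biUnion fun i => cubeCoset (k i)) = E :=
    Finset.eq_of_subset_of_card_le hsubE (by rw [hunion]; exact card_erase_zero_le)
  have hcardE : E.card = 3 * n := by rw [← hEeq, hunion]
  have hcover : ∀ x : F, x ≠ 0 → ∃ i, x ∈ cubeCoset (k i) := by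
    intro x hx
    have : x ∈ E := Finset.mem_erase.2 ⟨hx, Finset.mem_univ _⟩
    rw [← hEeq] at this
    simpa using this
  have hadd : ∀ x y : F, x ≠ 0 → y ≠ 0 → y ∉ cubeCoset x →
      x + y ∈ cubeCoset x ∨ x + y ∈ cubeCoset y := by
    intro x y hx hy hxy
    have hxy0 : x + y ≠ 0 := by
      intro h
      refine hxy (mem_cubeCoset.2 ⟨-1, by simp, ?_⟩)
      linear_combination -h
    obtain ⟨i, hi⟩ := hcover x hx
    obtain ⟨j, hj⟩ := hcover y hy
    obtain ⟨l, hl⟩ := hcover _ hxy0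
    by_contra! hc
    have hij : i ≠ j := by
      rintro rfl
      exact hxy (cubeCoset_trans (cubeCoset_symm hi) hj)
    have hil : i ≠ l := by
      rintro rfl
      exact hc.1 (cubeCoset_trans (cubeCoset_symm hi) hl)
    have hjl : j ≠ l := by
      rintro rfl
      exact hc.2 (cubeCoset_trans (cubeCoset_symm hj) hl)
    obtain ⟨t, ht, rfl⟩ := mem_cubeCoset.1 hi
    obtain ⟨u, hu, rfl⟩ := mem_cubeCoset.1 hj
    obtain ⟨w, hw, hw'⟩ := mem_cubeCoset.1 hl
    refine hno (Pi.single i t + Pi.single j u - Pi.single l w) ?_ ?_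
    · intro h0
      have := congrFun h0 i
      simp [hij, hil] at this
      exact ht this
    · have huniv : (Finset.univ : Finset (Fin 3)) = {i, j, l} := by
        symm
        rw [← Finset.card_eq_iff_eq_univ, Finset.card_eq_three.2 ⟨i, j, l, hij, hil, hjl, rfl⟩]
        rfl
      rw [huniv, Finset.sum_insert (by simp [hij, hil]), Finset.sum_pair hjl]
      simp [hij, hij.symm, hil, hil.symm, hjl, hjl.symm]
      linear_combination -hw'
  have hn0 : 0 < n := Finset.card_pos.2 ⟨1, self_mem_cubeCoset 1⟩
  -- The value x + y is an element of the coset of x other than x itself, since y ≠ 0.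
  have hshift : ∀ x ∈ E, (E.filter fun y => x + y ∈ cubeCoset x).card ≤ n - 1 := by
    intro x hx
    have hx0 := Finset.ne_of_mem_erase hx
    rw [hn, ← card_cubeCoset hx0, ← Finset.card_erase_of_mem (self_mem_cubeCoset x)]
    refine Finset.card_le_card_of_injOn (fun y => x + y) ?_ (add_right_injective x).injOn
    intro y hy
    rw [Finset.mem_coe, Finset.mem_filter] at hy
    rw [Finset.mem_coe, Finset.mem_erase]
    refine ⟨?_, hy.2⟩
    simpa using Finset.ne_of_mem_erase hy.1
  have hS : ((E ×ˢ E).filter fun z => z.2 ∉ cubeCoset z.1).card = E.card * (2 * n) := by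
    rw [Finset.card_filter, Finset.sum_product]
    simp_rw [← Finset.card_filter]
    rw [Finset.sum_congr rfl (g := fun _ => 2 * n), Finset.sum_const, smul_eq_mul]
    intro x hx
    have hx0 := Finset.ne_of_mem_erase hx
    rw [← Finset.sdiff_eq_filter, Finset.card_sdiff_of_subset (hsub x hx0), card_cubeCoset hx0,
      hcardE]
    omega
  have hS1 : ((E ×ˢ E).filter fun z => z.1 + z.2 ∈ cubeCoset z.1).card ≤ E.card * (n - 1) := by
    rw [Finset.card_filter, Finset.sum_product]
    simp_rw [← Finset.card_filter]
    exact (Finset.sum_le_sum hshift).trans (by rw [Finset.sum_const, smul_eq_mul])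
  have hS2 : ((E ×ˢ E).filter fun z => z.1 + z.2 ∈ cubeCoset z.2).card ≤ E.card * (n - 1) := by
    rw [Finset.card_filter, Finset.sum_product_right]
    simp_rw [← Finset.card_filter]
    refine (Finset.sum_le_sum fun y hy => ?_).trans_eq (by rw [Finset.sum_const, smul_eq_mul])
    simpa only [add_comm y] using hshift y hy
  have hle : E.card * (2 * n) ≤ E.card * (n - 1) + E.card * (n - 1) := by
    rw [← hS]
    refine le_trans (Finset.card_le_card ?_) ((Finset.card_union_le _ _).trans
      (Nat.add_le_add hS1 hS2))
    rintro ⟨x, y⟩ h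
    simp only [Finset.mem_filter, Finset.mem_product, Finset.mem_union] at h ⊢
    rcases hadd x y (Finset.ne_of_mem_erase h.1.1) (Finset.ne_of_mem_erase h.1.2) h.2 with h1 | h1
    · exact Or.inl ⟨h.1, h1⟩
    · exact Or.inr ⟨h.1, h1⟩
  rw [← mul_add] at hle
  have := Nat.le_of_mul_le_mul_left hle (by omega)
  omega

end FiniteField

/-! ### Hensel lifting of cube roots -/

section Hensel

variable {p : ℕ} [Fact p.Prime]

lemma exists_cube_root_of_norm_lt {u t : ℤ_[p]} (h : ‖t ^ 3 - u‖ < ‖3 * t ^ 2‖ ^ 2) :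
    ∃ w : ℤ_[p], w ^ 3 = u := by
  obtain ⟨z, hz, -⟩ := hensels_lemma (p := p) (R := ℤ_[p])
    (F := Polynomial.X ^ 3 - Polynomial.C u) (a := t)
    (by simpa [show (2 : ℤ_[p]) + 1 = 3 by norm_num] using h)
  exact ⟨z, by simpa [sub_eq_zero] using hz⟩

lemma norm_three_eq_one (hp3 : p ≠ 3) : ‖(3 : ℤ_[p])‖ = 1 := by
  have h : ¬ ‖((3 : ℤ) : ℤ_[p])‖ < 1 := by
    rw [PadicInt.norm_int_lt_one_iff_dvd]
    intro h
    have h1 : p ∣ 3 := by exact_mod_cast h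
    exact hp3 ((Nat.prime_dvd_prime_iff_eq Fact.out Nat.prime_three).1 h1)
  have h2 := PadicInt.norm_le_one (3 : ℤ_[p])
  push_cast at h
  linarith

/-- A diagonal cubic form in three variables with unit coefficients is isotropic over `ℤ_p`,
`p ≠ 3`. -/
theorem exists_padicInt_diagonal_cubic_zero (hp3 : p ≠ 3) (k : Fin 3 → ℤ_[p])
    (hk : ∀ i, ‖k i‖ = 1) : ∃ v : Fin 3 → ℤ_[p], v ≠ 0 ∧ ∑ i, k i * v i ^ 3 = 0 := by
  have hunit : ∀ z : ℤ_[p], PadicInt.toZMod z = 0 ↔ ‖z‖ < 1 := by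
    intro z
    rw [← RingHom.mem_ker, PadicInt.ker_toZMod, IsLocalRing.mem_maximalIdeal, PadicInt.mem_nonunits]
  obtain ⟨v, hv, hsum⟩ := exists_diagonal_cubic_zero (fun i => PadicInt.toZMod (k i)) fun i h => by
    rw [hunit, hk] at h
    exact lt_irrefl _ h
  obtain ⟨V, hV⟩ : ∃ V : Fin 3 → ℤ_[p], ∀ i, PadicInt.toZMod (V i) = v i :=
    ⟨fun i => ((v i).val : ℤ_[p]), fun i => by simp⟩
  obtain ⟨i, hi⟩ := Function.ne_iff.1 hv
  obtain ⟨c, hc⟩ : ∃ c : ℤ_[p], k i * c = 1 := (PadicInt.isUnit_iff.2 (hk i)).exists_right_inv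
  have hVi : ‖V i‖ = 1 := by
    refine le_antisymm (PadicInt.norm_le_one _) (not_lt.1 fun h => hi ?_)
    rw [← hV, Pi.zero_apply]
    exact (hunit _).2 h
  set R := ∑ j ∈ Finset.univ.erase i, k j * V j ^ 3 with hR
  have hsplit : ∀ w : ℤ_[p], ∑ j, k j * (Function.update V i w j) ^ 3 = k i * w ^ 3 + R := by
    intro w
    rw [← Finset.add_sum_erase _ _ (Finset.mem_univ i), Function.update_self, hR]
    congr 1
    refine Finset.sum_congr rfl fun j hj => ?_
    rw [Function.update_of_ne (Finset.ne_of_mem_erase hj)]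
  have hred : ‖V i ^ 3 - -(c * R)‖ < 1 := by
    rw [← hunit]
    have h1 : V i ^ 3 - -(c * R) = c * (k i * V i ^ 3 + R) := by
      linear_combination -(V i ^ 3) * hc
    rw [h1, ← hsplit, Function.update_eq_self, map_mul, map_sum]
    simp only [map_mul, map_pow, hV]
    rw [hsum, mul_zero]
  -- The other two coordinates stay fixed; V i is a unit and 3 is a unit, so the zero modulo p lifts
  -- in coordinate i.
  obtain ⟨w, hw⟩ := exists_cube_root_of_norm_lt (u := -(c * R)) (t := V i) (by
    rw [norm_mul, norm_pow, hVi, norm_three_eq_one hp3]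
    simpa using hred)
  refine ⟨Function.update V i w, ?_, ?_⟩
  · intro h0
    have hw0 : w = 0 := by simpa using congrFun h0 i
    rw [hw0] at hw
    rw [← hw] at hred
    simp [hVi] at hred
  · rw [hsplit, hw]
    linear_combination -R * hc

/-- The approximate root 1 + 3k has error 27(k^2 + k^3), of norm at most 1/27, while the squared
norm of the derivative is 1/9. Starting from 1 would not meet this criterion in general. -/
lemma exists_cube_root_of_one_add_nine_mul (k : ℤ_[3]) : ∃ w : ℤ_[3], w ^ 3 = 1 + 9 * k := by
  have h3 : ‖(3 : ℤ_[3])‖ = 1 / 3 := by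
    have := PadicInt.norm_p (p := 3)
    push_cast at this
    rw [this]
    norm_num
  refine exists_cube_root_of_norm_lt (t := 1 + 3 * k) ?_
  have h1 : (1 + 3 * k) ^ 3 - (1 + 9 * k) = 3 ^ 3 * (k ^ 2 + k ^ 3) := by ring
  have h2 : ‖1 + 3 * k‖ = 1 := by
    rw [← PadicInt.isUnit_iff]
    by_contra h
    have h4 := PadicInt.not_isUnit_iff.1 h
    have h5 : ‖(3 : ℤ_[3]) * k‖ < 1 := by
      rw [norm_mul, h3]
      have := PadicInt.norm_le_one k
      linarith
    have h6 : ‖(1 : ℤ_[3])‖ < 1 := by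
      have e : (1 : ℤ_[3]) = (1 + 3 * k) + -(3 * k) := by ring
      rw [e]
      refine (PadicInt.nonarchimedean _ _).trans_lt (max_lt h4 ?_)
      rwa [norm_neg]
    simp at h6
  rw [h1, norm_mul, norm_mul, norm_pow, norm_pow, h2, h3]
  have := PadicInt.norm_le_one (k ^ 2 + k ^ 3)
  norm_num
  linarith

/-- Up to cubes, a `3`-adic unit is `1`, `2` or `4`. -/
lemma exists_unit_mul_cube_eq (u : ℤ_[3]) (hu : ‖u‖ = 1) :
    ∃ (e : Fin 3) (c : ℤ_[3]), u * c ^ 3 = 2 ^ (e : ℕ) := by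
  obtain ⟨v, hv⟩ := (PadicInt.isUnit_iff.2 hu).exists_right_inv
  -- The units modulo 9 are ± a power 2^e with e < 3, so 2^e / u is ±1 modulo 9 for some e, and an
  -- element congruent to 1 modulo 9 is a cube.
  have hdec : ∀ x y : ZMod (3 ^ 2), x * y = 1 →
      ∃ e : Fin 3, 2 ^ (e : ℕ) * y = 1 ∨ -(2 ^ (e : ℕ) * y) = 1 := by decide
  obtain ⟨e, he⟩ := hdec (PadicInt.toZModPow 2 u) (PadicInt.toZModPow 2 v)
    (by rw [← map_mul, hv, map_one])
  have hroot : ∀ z : ℤ_[3], PadicInt.toZModPow 2 z = 1 → ∃ w : ℤ_[3], w ^ 3 = z := by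
    intro z hz
    have h1 : z - 1 ∈ RingHom.ker (PadicInt.toZModPow (p := 3) 2) := by
      rw [RingHom.mem_ker, map_sub, hz, map_one, sub_self]
    rw [PadicInt.ker_toZModPow, Ideal.mem_span_singleton] at h1
    obtain ⟨k, hk⟩ := h1
    obtain ⟨w, hw⟩ := exists_cube_root_of_one_add_nine_mul k
    refine ⟨w, ?_⟩
    rw [hw]
    push_cast at hk
    linear_combination -hk
  refine ⟨e, ?_⟩
  rcases he with he | he
  · obtain ⟨w, hw⟩ := hroot (2 ^ (e : ℕ) * v) (by rwa [map_mul, map_pow, map_ofNat])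
    exact ⟨w, by rw [hw]; linear_combination (2 ^ (e : ℕ)) * hv⟩
  · obtain ⟨w, hw⟩ := hroot (-(2 ^ (e : ℕ) * v))
      (by rwa [map_neg, map_mul, map_pow, map_ofNat])
    exact ⟨-w, by linear_combination (-u) * hw + (2 ^ (e : ℕ)) * hv⟩

end Hensel

end CubicPair

namespace CubicPair

/-! ### Isotropy of diagonal cubic forms in seven variables over ℚ_p -/

section Isotropy

variable {ι K : Type*} [Field K]

/-- The diagonal cubic form with coefficients `γ j`, `j ∈ T`, has a nontrivial zero. -/
def IsotropicOn (T : Finset ι) (γ : ι → K) : Prop :=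
  ∃ y : ι → K, y ≠ 0 ∧ (∀ j, j ∉ T → y j = 0) ∧ ∑ j ∈ T, γ j * y j ^ 3 = 0

lemma IsotropicOn.of_injective {n : ℕ} {T : Finset ι} {γ : ι → K} (f : Fin n → ι)
    (hf : Function.Injective f) (hT : ∀ i, f i ∈ T) (v : Fin n → K) (hv : v ≠ 0)
    (h : ∑ i, γ (f i) * v i ^ 3 = 0) : IsotropicOn T γ := by
  classical
  have hout : ∀ j, j ∉ Finset.univ.map ⟨f, hf⟩ → Function.extend f v 0 j = 0 := by
    intro j hj
    refine Function.extend_apply' _ _ _ ?_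
    rintro ⟨i, rfl⟩
    exact hj (by simp)
  have hsub : Finset.univ.map ⟨f, hf⟩ ⊆ T := by
    intro j hj
    obtain ⟨i, -, rfl⟩ := Finset.mem_map.1 hj
    exact hT i
  refine ⟨Function.extend f v 0, ?_, fun j hj => hout j fun h' => hj (hsub h'), ?_⟩
  · intro h0
    apply hv
    ext i
    rw [← hf.extend_apply v 0 i, h0]
    rfl
  · rw [← Finset.sum_subset hsub fun j _ hj => by rw [hout j hj]; ring, Finset.sum_map, ← h]
    refine Finset.sum_congr rfl fun i _ => ?_
    simp [hf.extend_apply]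

end Isotropy

section Padic

variable {p : ℕ} [Fact p.Prime]

/-- Normal form of a nonzero `p`-adic number up to cubes. -/
lemma exists_mul_cube_eq {γ : ℚ_[p]} (hγ : γ ≠ 0) :
    ∃ (c : ℚ_[p]) (r : Fin 3) (u : ℤ_[p]),
      c ≠ 0 ∧ ‖u‖ = 1 ∧ γ * c ^ 3 = (p : ℚ_[p]) ^ (r : ℕ) * u := by
  have hp : p.Prime := Fact.out
  have hp0 : (p : ℚ_[p]) ≠ 0 := by exact_mod_cast hp.ne_zero
  have hpR : (p : ℝ) ≠ 0 := by exact_mod_cast hp.ne_zero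
  set m := γ.valuation / 3 with hm
  have hr0 := Int.emod_nonneg γ.valuation (by norm_num : (3 : ℤ) ≠ 0)
  have hr3 := Int.emod_lt_of_pos γ.valuation (by norm_num : (0 : ℤ) < 3)
  obtain ⟨r, hr⟩ := Int.eq_ofNat_of_zero_le hr0
  have hval : γ.valuation = 3 * m + r := by
    rw [← hr, hm]
    exact (Int.mul_ediv_add_emod _ _).symm
  have hnorm : ‖γ * ((p : ℚ_[p]) ^ (-m)) ^ 3 * (p : ℚ_[p]) ^ (-(r : ℤ))‖ = 1 := by
    rw [norm_mul, norm_mul, norm_pow, Padic.norm_p_zpow, Padic.norm_p_zpow,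
      Padic.norm_eq_zpow_neg_valuation hγ, hval, ← zpow_natCast, ← zpow_mul, ← zpow_add₀ hpR,
      ← zpow_add₀ hpR]
    convert zpow_zero (p : ℝ) using 2
    push_cast
    ring
  refine ⟨(p : ℚ_[p]) ^ (-m), ⟨r, by omega⟩, ⟨_, hnorm.le⟩, zpow_ne_zero _ hp0, hnorm, ?_⟩
  simp only [zpow_neg, zpow_natCast]
  field_simp

/-- Among seven coefficients three have valuations congruent modulo 3. After scaling by cubes and
removing the common power of p they are units, and three unit coefficients suffice. -/
lemma isotropicOn_of_ne_three (hp3 : p ≠ 3) {ι : Type*} (T : Finset ι) (hT : 7 ≤ T.card)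
    (γ : ι → ℚ_[p]) (hγ : ∀ j ∈ T, γ j ≠ 0) : IsotropicOn T γ := by
  have h := fun j (hj : j ∈ T) => exists_mul_cube_eq (hγ j hj)
  choose! c r u hc hu h using h
  obtain ⟨y, -, hy⟩ := Finset.exists_lt_card_fiber_of_mul_lt_card_of_maps_to
    (f := r) (s := T) (t := Finset.univ) (n := 2) (fun _ _ => Finset.mem_univ _)
    (by rw [Finset.card_univ, Fintype.card_fin]; omega)
  obtain ⟨i, hi, j, hj, l, hl, hij, hil, hjl⟩ := Finset.two_lt_card.1 hy
  rw [Finset.mem_filter] at hi hj hl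
  set f : Fin 3 → ι := ![i, j, l] with hf
  have hfT : ∀ t, f t ∈ T ∧ r (f t) = y := by
    intro t
    fin_cases t
    · exact hi
    · exact hj
    · exact hl
  have hinj : Function.Injective f := by
    intro t t' htt
    fin_cases t <;> fin_cases t' <;> simp_all
  obtain ⟨v, hv, hsum⟩ := exists_padicInt_diagonal_cubic_zero hp3 (fun t => u (f t))
    fun t => hu _ (hfT t).1
  refine IsotropicOn.of_injective f hinj (fun t => (hfT t).1) (fun t => c (f t) * v t) ?_ ?_
  · obtain ⟨t, ht⟩ := Function.ne_iff.1 hv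
    refine Function.ne_iff.2 ⟨t, mul_ne_zero (hc _ (hfT t).1) ?_⟩
    simpa using ht
  · have h1 : ∑ t, (u (f t) : ℚ_[p]) * (v t : ℚ_[p]) ^ 3 = 0 := by
      have h0 := congrArg PadicInt.Coe.ringHom hsum
      simp only [map_sum, map_mul, map_pow, map_zero] at h0
      exact h0
    have h2 : ∀ t, γ (f t) * (c (f t) * v t) ^ 3 =
        (p : ℚ_[p]) ^ (y : ℕ) * ((u (f t) : ℚ_[p]) * (v t : ℚ_[p]) ^ 3) := by
      intro t
      have := h _ (hfT t).1
      rw [(hfT t).2] at this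
      linear_combination (v t : ℚ_[p]) ^ 3 * this
    simp_rw [h2]
    rw [← Finset.mul_sum, h1, mul_zero]

lemma exists_three_adic_mul_cube_eq {γ : ℚ_[3]} (hγ : γ ≠ 0) :
    ∃ (c : ℚ_[3]) (r e : Fin 3), c ≠ 0 ∧ γ * c ^ 3 = 3 ^ (r : ℕ) * 2 ^ (e : ℕ) := by
  obtain ⟨c, r, u, hc, hu, h⟩ := exists_mul_cube_eq hγ
  obtain ⟨e, w, hw⟩ := exists_unit_mul_cube_eq u hu
  have hw' : (u : ℚ_[3]) * (w : ℚ_[3]) ^ 3 = 2 ^ (e : ℕ) := by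
    exact_mod_cast congrArg (fun z : ℤ_[3] => (z : ℚ_[3])) hw
  have hw0 : (w : ℚ_[3]) ≠ 0 := by
    intro h0
    rw [h0] at hw'
    exact pow_ne_zero (e : ℕ) (two_ne_zero : (2 : ℚ_[3]) ≠ 0) (by rw [← hw']; ring)
  refine ⟨c * w, r, e, mul_ne_zero hc hw0, ?_⟩
  push_cast at h
  linear_combination (w : ℚ_[3]) ^ 3 * h + 3 ^ (r : ℕ) * hw'

/-- Among seven of the nine classes of `3`-adic numbers up to sign and cubes there is a full level
followed by a nonempty one. -/
lemma exists_full_level (S : Finset (Fin 3 × Fin 3)) (hS : 7 ≤ S.card) :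
    ∃ r, (∀ e, (r, e) ∈ S) ∧ ∃ e, (r + 1, e) ∈ S := by
  have hcompl : Sᶜ.card ≤ 2 := by
    rw [Finset.card_compl]
    simp
    omega
  have hthree : ∀ g : Fin 3 → Fin 3 × Fin 3, Function.Injective g → ∃ t, g t ∈ S := by
    intro g hg
    by_contra! hc
    have := Finset.card_le_card (s := Finset.univ.map ⟨g, hg⟩) (t := Sᶜ) (by
      intro x hx
      obtain ⟨t, -, rfl⟩ := Finset.mem_map.1 hx
      exact Finset.mem_compl.2 (hc t))
    rw [Finset.card_map, Finset.card_univ, Fintype.card_fin] at this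
    omega
  have hfull : ∃ r, ∀ e, (r, e) ∈ S := by
    by_contra! hc
    choose f hf using hc
    obtain ⟨t, ht⟩ := hthree (fun r => (r, f r)) fun r r' h => (Prod.mk.inj h).1
    exact hf t ht
  obtain ⟨r, hr⟩ := hfull
  obtain ⟨e, he⟩ := hthree (fun e => (r + 1, e)) fun e e' h => (Prod.mk.inj h).2
  exact ⟨r, hr, e, he⟩

/-- The zeros come from the identities 1 - 2 + 4 - 3 = 0, -8 - 2 + 4 + 6 = 0 and 8 + 4 - 12 = 0, for
e = 0, 1, 2. -/
lemma exists_quaternary_zero {K : Type*} [Field K] [CharZero K] (r e : Fin 3) :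
    ∃ v : Fin 4 → K, v ≠ 0 ∧ 3 ^ (r : ℕ) * 2 ^ 0 * v 0 ^ 3 + 3 ^ (r : ℕ) * 2 ^ 1 * v 1 ^ 3 +
      3 ^ (r : ℕ) * 2 ^ 2 * v 2 ^ 3 + 3 ^ ((r + 1 : Fin 3) : ℕ) * 2 ^ (e : ℕ) * v 3 ^ 3 = 0 := by
  obtain ⟨x, hx0, hx⟩ : ∃ x : Fin 4 → K, x ≠ 0 ∧
      x 0 ^ 3 + 2 * x 1 ^ 3 + 4 * x 2 ^ 3 + 3 * 2 ^ (e : ℕ) * x 3 ^ 3 = 0 := by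
    fin_cases e
    · refine ⟨![1, -1, 1, -1], fun h => by simpa using congrFun h 2, ?_⟩
      simp
      norm_num
    · refine ⟨![-2, -1, 1, 1], fun h => by simpa using congrFun h 2, ?_⟩
      simp
      norm_num
    · refine ⟨![2, 0, 1, -1], fun h => by simpa using congrFun h 2, ?_⟩
      simp
      norm_num
  -- The index r + 1 is taken in `Fin 3`; for r = 2 it wraps to 0, and l = 3 makes up the missing
  -- 27.
  obtain ⟨l, hl0, hl⟩ : ∃ l : K, l ≠ 0 ∧
      (3 : K) ^ ((r + 1 : Fin 3) : ℕ) * l ^ 3 = 3 ^ (r : ℕ) * 3 := by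
    fin_cases r
    · exact ⟨1, one_ne_zero, by simp⟩
    · exact ⟨1, one_ne_zero, by simp; norm_num⟩
    · exact ⟨3, three_ne_zero, by simp; norm_num⟩
  refine ⟨![x 0, x 1, x 2, l * x 3], ?_, ?_⟩
  · intro h
    apply hx0
    ext t
    fin_cases t
    · simpa using congrFun h 0
    · simpa using congrFun h 1
    · simpa using congrFun h 2
    · have := congrFun h 3
      simpa [hl0] using this
  · simp
    linear_combination 3 ^ (r : ℕ) * hx + 2 ^ (e : ℕ) * x 3 ^ 3 * hl

/-- There are nine classes 3^r 2^e up to cubes. Two coefficients in one class cancel, since -1 is a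
cube; otherwise seven classes occur, and a full level followed by a nonempty one gives a
four-variable zero. -/
lemma isotropicOn_three {ι : Type*} (T : Finset ι) (hT : 7 ≤ T.card)
    (γ : ι → ℚ_[3]) (hγ : ∀ j ∈ T, γ j ≠ 0) : IsotropicOn T γ := by
  classical
  have h := fun j (hj : j ∈ T) => exists_three_adic_mul_cube_eq (hγ j hj)
  choose! c r e hc h using h
  by_cases hinj : Set.InjOn (fun j => (r j, e j)) T
  · have hcard : 7 ≤ (T.image fun j => (r j, e j)).card := by
      rwa [Finset.card_image_of_injOn hinj]
    obtain ⟨ρ, hfull, e', he'⟩ := exists_full_level _ hcard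
    have h0 := hfull 0
    have h1 := hfull 1
    have h2 := hfull 2
    simp only [Finset.mem_image, Prod.mk.injEq] at h0 h1 h2 he'
    obtain ⟨i, hi, hri, hei⟩ := h0
    obtain ⟨j, hj, hrj, hej⟩ := h1
    obtain ⟨k, hk, hrk, hek⟩ := h2
    obtain ⟨l, hl, hrl, hel⟩ := he'
    obtain ⟨v, hv, hsum⟩ := exists_quaternary_zero (K := ℚ_[3]) ρ e'
    have hρ : ρ + 1 ≠ ρ := by fin_cases ρ <;> decide
    have hij : i ≠ j := by rintro rfl; exact absurd (hei.symm.trans hej) (by decide)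
    have hik : i ≠ k := by rintro rfl; exact absurd (hei.symm.trans hek) (by decide)
    have hjk : j ≠ k := by rintro rfl; exact absurd (hej.symm.trans hek) (by decide)
    have hil : i ≠ l := by rintro rfl; exact hρ (hrl.symm.trans hri)
    have hjl : j ≠ l := by rintro rfl; exact hρ (hrl.symm.trans hrj)
    have hkl : k ≠ l := by rintro rfl; exact hρ (hrl.symm.trans hrk)
    refine IsotropicOn.of_injective ![i, j, k, l] ?_ ?_
      ![c i * v 0, c j * v 1, c k * v 2, c l * v 3] ?_ ?_
    · intro t t' htt
      fin_cases t <;> fin_cases t' <;> simp_all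
    · intro t
      fin_cases t
      exacts [hi, hj, hk, hl]
    · intro h0
      apply hv
      ext t
      fin_cases t
      · simpa [hc i hi] using congrFun h0 0
      · simpa [hc j hj] using congrFun h0 1
      · simpa [hc k hk] using congrFun h0 2
      · simpa [hc l hl] using congrFun h0 3
    · have gi := h i hi
      have gj := h j hj
      have gk := h k hk
      have gl := h l hl
      rw [hri, hei] at gi
      rw [hrj, hej] at gj
      rw [hrk, hek] at gk
      rw [hrl, hel] at gl
      simp only [Fin.val_zero, Fin.val_one, Fin.val_two] at gi gj gk
      rw [Fin.sum_univ_four]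
      simp only [Matrix.cons_val]
      linear_combination v 0 ^ 3 * gi + v 1 ^ 3 * gj + v 2 ^ 3 * gk + v 3 ^ 3 * gl + hsum
  · simp only [Set.InjOn, not_forall] at hinj
    obtain ⟨i, hi, j, hj, hre, hij⟩ := hinj
    rw [Prod.mk.injEq] at hre
    refine IsotropicOn.of_injective ![i, j] ?_ ?_ ![c i, -c j] ?_ ?_
    · intro t t' htt
      fin_cases t <;> fin_cases t' <;> simp_all
    · intro t
      fin_cases t
      exacts [hi, hj]
    · intro h0
      exact hc i hi (by simpa using congrFun h0 0)
    · have gi := h i hi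
      have gj := h j hj
      rw [hre.1, hre.2] at gi
      rw [Fin.sum_univ_two]
      simp only [Matrix.cons_val]
      linear_combination gi - gj

/-- Diagonal cubic forms in at least seven variables over `ℚ_p` are isotropic. -/
theorem isotropicOn_of_seven_le {ι : Type*} (T : Finset ι) (hT : 7 ≤ T.card)
    (γ : ι → ℚ_[p]) (hγ : ∀ j ∈ T, γ j ≠ 0) : IsotropicOn T γ := by
  rcases eq_or_ne p 3 with rfl | hp3
  · exact isotropicOn_three T hT γ hγ
  · exact isotropicOn_of_ne_three hp3 T hT γ hγ

end Padic

end CubicPair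

namespace CubicPair

/-! ### Positivity of the local densities -/

variable {s : ℕ} {p : ℕ} [Fact p.Prime]

/-- Cubing has nonzero derivative at x, so it is open there by the inverse function theorem. -/
lemma eventually_exists_cube_eq {x : ℚ_[p]} (hx : x ≠ 0) {V : Set ℚ_[p]} (hV : V ∈ 𝓝 x) :
    ∀ᶠ c in 𝓝 (x ^ 3), ∃ w ∈ V, w ^ 3 = c := by
  have h := (hasStrictDerivAt_pow 3 x).map_nhds_eq (by simp [hx])
  have h1 := image_mem_map (m := fun w : ℚ_[p] => w ^ 3) hV
  rw [h] at h1
  exact h1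

/-- Columns with a vanishing linear combination `∑ minor i j * y j ^ 3` give a vector proportional
to the `i`-th column. -/
lemma exists_proportional (a b : Fin s → ℤ) (hab : ∀ j, (a j, b j) ≠ (0, 0)) (i : Fin s)
    (y : Fin s → ℚ_[p]) (hy : ∑ j, (minor a b i j : ℚ_[p]) * y j ^ 3 = 0) :
    ∃ l : ℚ_[p], ∑ j, (a j : ℚ_[p]) * y j ^ 3 = a i * l ∧ ∑ j, (b j : ℚ_[p]) * y j ^ 3 = b i * l := by
  have h1 : (a i : ℚ_[p]) * ∑ j, (b j : ℚ_[p]) * y j ^ 3 =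
      b i * ∑ j, (a j : ℚ_[p]) * y j ^ 3 := by
    rw [← sub_eq_zero, Finset.mul_sum, Finset.mul_sum, ← Finset.sum_sub_distrib, ← hy]
    refine Finset.sum_congr rfl fun j _ => ?_
    unfold minor
    push_cast
    ring
  by_cases ha : a i = 0
  · have hb : (b i : ℚ_[p]) ≠ 0 := by
      intro hb
      exact hab i (by rw [ha, Int.cast_eq_zero.1 hb])
    rw [ha, Int.cast_zero, zero_mul, eq_comm, mul_eq_zero] at h1
    refine ⟨(∑ j, (b j : ℚ_[p]) * y j ^ 3) / b i, ?_, by field_simp⟩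
    rw [ha, h1.resolve_left hb]
    simp
  · have ha' : (a i : ℚ_[p]) ≠ 0 := Int.cast_ne_zero.2 ha
    refine ⟨(∑ j, (a j : ℚ_[p]) * y j ^ 3) / a i, by field_simp, ?_⟩
    field_simp
    linear_combination h1

/-- A nontrivial `p`-adic solution can be deformed into a nonsingular one. -/
lemma exists_nonsingular_solution (a b : Fin s → ℤ) (hab : ∀ j, (a j, b j) ≠ (0, 0)) (hs : 13 ≤ s)
    (hL : ∀ c d : ℤ, (c, d) ≠ (0, 0) →
      s - 6 ≤ (Finset.univ.filter (fun j : Fin s => c * a j + d * b j ≠ 0)).card)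
    (h : HasNontrivialSolution a b ℚ_[p]) :
    ∃ x : Fin s → ℚ_[p], IsSolution a b x ∧ ∃ i j, x i ≠ 0 ∧ x j ≠ 0 ∧ minor a b i j ≠ 0 := by
  have hp : p.Prime := Fact.out
  obtain ⟨x, hx0, hx⟩ := h
  by_cases hsing : ∃ i j, x i ≠ 0 ∧ x j ≠ 0 ∧ minor a b i j ≠ 0
  · exact ⟨x, hx, hsing⟩
  push Not at hsing
  obtain ⟨i, hi⟩ := Function.ne_iff.1 hx0
  rw [Pi.zero_apply] at hi
  -- In the singular case the support of x consists of columns proportional to column i, so it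
  -- avoids T. As T has at least seven elements, there is y ≠ 0 supported on T whose image is a
  -- multiple l of column i. For small t ≠ 0 the vector x + ty, with coordinate i corrected to
  -- absorb t^3 l, is a solution with two independent columns in its support.
  set T := Finset.univ.filter fun j => ¬ minor a b i j = 0 with hT
  have hTcard : 7 ≤ T.card := by
    have h1 := card_minor_eq_zero_le a b hab hs hL i
    have h2 := Finset.card_filter_add_card_filter_not
      (s := (Finset.univ : Finset (Fin s))) (fun j => minor a b i j = 0)
    rw [Finset.card_univ, Fintype.card_fin] at h2
    rw [hT]
    omega
  obtain ⟨y, hy0, hyT, hy⟩ := isotropicOn_of_seven_le (p := p) T hTcard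
    (fun j => (minor a b i j : ℚ_[p]))
    fun j hj => Int.cast_ne_zero.2 (Finset.mem_filter.1 hj).2
  have hmT : ∀ j, j ∉ T → minor a b i j = 0 := by
    intro j hj
    by_contra hc
    exact hj (Finset.mem_filter.2 ⟨Finset.mem_univ _, hc⟩)
  have hy' : ∑ j, (minor a b i j : ℚ_[p]) * y j ^ 3 = 0 := by
    rw [← hy]
    symm
    refine Finset.sum_subset (Finset.subset_univ T) fun j _ hj => ?_
    simp [hmT j hj]
  obtain ⟨l, hla, hlb⟩ := exists_proportional a b hab i y hy'
  have hyi : y i = 0 := hyT i fun hc => (Finset.mem_filter.1 hc).2 (by unfold minor; ring)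
  have hxy : ∀ j, x j * y j = 0 := by
    intro j
    by_cases hj : j ∈ T
    · by_cases hxj : x j = 0
      · rw [hxj, zero_mul]
      · exact absurd (hsing i j hi hxj) (Finset.mem_filter.1 hj).2
    · rw [hyT j hj, mul_zero]
  have hev : ∀ᶠ t : ℚ_[p] in 𝓝 0, ∃ w ∈ ({0}ᶜ : Set ℚ_[p]), w ^ 3 = x i ^ 3 - t ^ 3 * l := by
    have hc : Tendsto (fun t : ℚ_[p] => x i ^ 3 - t ^ 3 * l) (𝓝 0) (𝓝 (x i ^ 3)) := by
      have : Continuous fun t : ℚ_[p] => x i ^ 3 - t ^ 3 * l := by fun_prop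
      simpa using this.tendsto 0
    exact hc.eventually (eventually_exists_cube_eq hi (isOpen_compl_singleton.mem_nhds hi))
  obtain ⟨t, ht0, w, hw0, hw⟩ : ∃ t : ℚ_[p], t ≠ 0 ∧ ∃ w, w ≠ 0 ∧ w ^ 3 = x i ^ 3 - t ^ 3 * l := by
    have h1 : ∀ᶠ t : ℚ_[p] in 𝓝[≠] 0, t ≠ 0 := self_mem_nhdsWithin
    obtain ⟨t, ht0, w, hw0, hw⟩ := (h1.and (hev.filter_mono nhdsWithin_le_nhds)).exists
    exact ⟨t, ht0, w, hw0, hw⟩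
  have hsum : ∀ (f : Fin s → ℤ), ∑ j, (f j : ℚ_[p]) * x j ^ 3 = 0 →
      ∑ j, (f j : ℚ_[p]) * y j ^ 3 = f i * l →
      ∑ j, (f j : ℚ_[p]) * (Function.update (fun k => x k + t * y k) i w j) ^ 3 = 0 := by
    intro f h1 h2
    have h3 : ∑ j, (f j : ℚ_[p]) * (x j + t * y j) ^ 3 = t ^ 3 * (f i * l) := by
      rw [← h2, Finset.mul_sum, ← add_zero (∑ j, t ^ 3 * _), ← h1, ← Finset.sum_add_distrib]
      refine Finset.sum_congr rfl fun j _ => ?_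
      linear_combination (f j * (3 * t * x j + 3 * t ^ 2 * y j) : ℚ_[p]) * hxy j
    rw [← Finset.add_sum_erase _ _ (Finset.mem_univ i)] at h3 ⊢
    rw [Function.update_self, Finset.sum_congr rfl fun j hj => by
      rw [Function.update_of_ne (Finset.ne_of_mem_erase hj)]]
    rw [hyi] at h3
    linear_combination h3 + (f i : ℚ_[p]) * hw
  obtain ⟨j, hj⟩ := Function.ne_iff.1 hy0
  rw [Pi.zero_apply] at hj
  have hjT : j ∈ T := by
    by_contra hc
    exact hj (hyT j hc)
  have hji : j ≠ i := by
    rintro rfl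
    exact hj hyi
  refine ⟨Function.update (fun k => x k + t * y k) i w, ⟨hsum a hx.1 hla, hsum b hx.2 hlb⟩,
    i, j, ?_, ?_, (Finset.mem_filter.1 hjT).2⟩
  · rwa [Function.update_self]
  · rw [Function.update_of_ne hji]
    have hxj : x j = 0 := (mul_eq_zero.1 (hxy j)).resolve_right hj
    simpa [hxj] using ⟨ht0, hj⟩

/-- Clearing denominators. -/
lemma exists_integral_multiple (x : Fin s → ℚ_[p]) :
    ∃ (c : ℚ_[p]) (X : Fin s → ℤ_[p]), c ≠ 0 ∧ ∀ j, (X j : ℚ_[p]) = c * x j := by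
  have hev : ∀ᶠ c : ℚ_[p] in 𝓝 0, ‖fun j => c * x j‖ < 1 := by
    have hc : Continuous fun c : ℚ_[p] => ‖fun j => c * x j‖ := by fun_prop
    have h1 := hc.tendsto 0
    simp only [zero_mul] at h1
    have h2 : ‖(fun _ => 0 : Fin s → ℚ_[p])‖ = 0 := norm_zero
    rw [h2] at h1
    exact h1.eventually (gt_mem_nhds one_pos)
  have h1 : ∀ᶠ t : ℚ_[p] in 𝓝[≠] 0, t ≠ 0 := self_mem_nhdsWithin
  obtain ⟨c, hc0, hc⟩ := (h1.and (hev.filter_mono nhdsWithin_le_nhds)).exists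
  exact ⟨c, fun j => ⟨c * x j, ((norm_le_pi_norm (fun j => c * x j) j).trans hc.le)⟩, hc0,
    fun j => rfl⟩

lemma sum_update_update {R : Type*} [CommRing R] (f : Fin s → R) (y : Fin s → R) {i j : Fin s}
    (hij : i ≠ j) (u v : R) :
    ∑ k, f k * (Function.update (Function.update y i u) j v k) ^ 3 =
      ∑ k, f k * y k ^ 3 + f i * (u ^ 3 - y i ^ 3) + f j * (v ^ 3 - y j ^ 3) := by
  have h : ∀ g : Fin s → R, ∑ k, g k = g j + (g i + ∑ k ∈ (Finset.univ.erase j).erase i, g k) := by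
    intro g
    rw [Finset.add_sum_erase _ _ (Finset.mem_erase.2 ⟨hij, Finset.mem_univ _⟩),
      Finset.add_sum_erase _ _ (Finset.mem_univ _)]
  rw [h, h fun k => f k * y k ^ 3, Function.update_self, Function.update_of_ne hij,
    Function.update_self, Finset.sum_congr rfl (g := fun k => f k * y k ^ 3)]
  · ring
  · intro k hk
    have hk1 := Finset.ne_of_mem_erase hk
    have hk2 := Finset.ne_of_mem_erase (Finset.mem_of_mem_erase hk)
    rw [Function.update_of_ne hk2, Function.update_of_ne hk1]

/-- Near a nonsingular solution, all but two coordinates can be prescribed. -/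
lemma exists_solution_near (a b : Fin s → ℤ) {x : Fin s → ℤ_[p]} (hx : IsSolution a b x)
    {i j : Fin s} (hi : x i ≠ 0) (hj : x j ≠ 0) (hij : minor a b i j ≠ 0) :
    ∃ m : ℕ, ∀ y : Fin s → ℤ_[p], (∀ k, ‖y k - x k‖ ≤ (p : ℝ) ^ (-(m : ℤ))) →
      ∃ z : Fin s → ℤ_[p], IsSolution a b z ∧ ∀ k, k ≠ i → k ≠ j → z k = y k := by
  have hp : p.Prime := Fact.out
  have hne : i ≠ j := by
    rintro rfl
    exact hij (by unfold minor; ring)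
  set D : ℚ_[p] := (minor a b i j : ℚ_[p]) with hD
  have hD0 : D ≠ 0 := Int.cast_ne_zero.2 hij
  have hDeq : D = a i * b j - a j * b i := by
    rw [hD, minor]
    push_cast
    rfl
  set P : (Fin s → ℤ_[p]) → ℚ_[p] := fun y => ∑ k, (a k : ℚ_[p]) * (y k : ℚ_[p]) ^ 3 with hP
  set Q : (Fin s → ℤ_[p]) → ℚ_[p] := fun y => ∑ k, (b k : ℚ_[p]) * (y k : ℚ_[p]) ^ 3 with hQ
  have hcoe : ∀ k, Continuous fun y : Fin s → ℤ_[p] => (y k : ℚ_[p]) := fun k =>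
    continuous_subtype_val.comp (continuous_apply k)
  have hPc : Continuous P := by
    refine continuous_finsetSum _ fun k _ => ?_
    exact continuous_const.mul ((hcoe k).pow 3)
  have hQc : Continuous Q := by
    refine continuous_finsetSum _ fun k _ => ?_
    exact continuous_const.mul ((hcoe k).pow 3)
  have hsol := IsSolution.map PadicInt.Coe.ringHom hx
  have hPx : P x = 0 := hsol.1
  have hQx : Q x = 0 := hsol.2
  -- The errors P(y), Q(y) are removed by changing the cubes of coordinates i and j according to
  -- Cramer's rule with determinant D. At y = x the required value is x_k^3 ≠ 0, so nearby it is
  -- still a cube.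
  have hroot : ∀ (k : Fin s) (α β : ℚ_[p]), x k ≠ 0 →
      ∀ᶠ y in 𝓝 x, ∃ w : ℤ_[p], (w : ℚ_[p]) ^ 3 = (y k : ℚ_[p]) ^ 3 - (α * P y - β * Q y) / D := by
    intro k α β hk
    have hc : Continuous fun y : Fin s → ℤ_[p] =>
        (y k : ℚ_[p]) ^ 3 - (α * P y - β * Q y) / D :=
      ((hcoe k).pow 3).sub (((continuous_const.mul hPc).sub (continuous_const.mul hQc)).div_const D)
    have h1 := hc.tendsto x
    simp only [hPx, hQx, mul_zero, sub_zero, zero_div] at h1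
    have hk' : (x k : ℚ_[p]) ≠ 0 := by simpa using hk
    -- ℤ_p is open in ℚ_p, so the cube root can be taken integral.
    have hV : Set.range (Subtype.val : ℤ_[p] → ℚ_[p]) ∈ 𝓝 (x k : ℚ_[p]) :=
      PadicInt.isOpenEmbedding_coe.isOpen_range.mem_nhds ⟨x k, rfl⟩
    filter_upwards [h1.eventually (eventually_exists_cube_eq hk' hV)] with y hy
    obtain ⟨w, ⟨w', rfl⟩, hw⟩ := hy
    exact ⟨w', hw⟩
  obtain ⟨ε, hε0, hε⟩ := Metric.eventually_nhds_iff.1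
    ((hroot i (b j) (a j) hi).and (hroot j (-(b i : ℚ_[p])) (-(a i : ℚ_[p])) hj))
  have hp1 : (1 : ℝ) < p := by exact_mod_cast hp.one_lt
  obtain ⟨m, hm⟩ := exists_pow_lt_of_lt_one hε0 (inv_lt_one_of_one_lt₀ hp1)
  refine ⟨m, fun y hy => ?_⟩
  have hdist : dist y x < ε := by
    refine lt_of_le_of_lt ((dist_pi_le_iff (by positivity)).2 fun k => ?_) hm
    rw [dist_eq_norm]
    refine (hy k).trans_eq ?_
    rw [zpow_neg, zpow_natCast, inv_pow]
  obtain ⟨⟨u, hu⟩, v, hv⟩ := hε hdist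
  refine ⟨Function.update (Function.update y i u) j v, ⟨?_, ?_⟩, ?_⟩
  · rw [sum_update_update _ _ hne]
    have : ((∑ k, (a k : ℤ_[p]) * y k ^ 3 + a i * (u ^ 3 - y i ^ 3) + a j * (v ^ 3 - y j ^ 3) :
        ℤ_[p]) : ℚ_[p]) = P y + a i * ((u : ℚ_[p]) ^ 3 - (y i : ℚ_[p]) ^ 3) +
          a j * ((v : ℚ_[p]) ^ 3 - (y j : ℚ_[p]) ^ 3) := by
      simp [hP]
    rw [← PadicInt.coe_eq_zero, this, hu, hv]
    field_simp
    rw [hDeq]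
    ring
  · rw [sum_update_update _ _ hne]
    have : ((∑ k, (b k : ℤ_[p]) * y k ^ 3 + b i * (u ^ 3 - y i ^ 3) + b j * (v ^ 3 - y j ^ 3) :
        ℤ_[p]) : ℚ_[p]) = Q y + b i * ((u : ℚ_[p]) ^ 3 - (y i : ℚ_[p]) ^ 3) +
          b j * ((v : ℚ_[p]) ^ 3 - (y j : ℚ_[p]) ^ 3) := by
      simp [hQ]
    rw [← PadicInt.coe_eq_zero, this, hu, hv]
    field_simp
    rw [hDeq]
    ring
  · intro k hki hkj
    rw [Function.update_of_ne hkj, Function.update_of_ne hki]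

/-- The s - 2 free coordinates are prescribed as x_k + p^m ζ_k with 0 ≤ ζ_k < p^n; different choices
remain distinct modulo p^(m+n). -/
lemma pow_le_solutionCount (a b : Fin s → ℤ) {x : Fin s → ℤ_[p]} {i j : Fin s} (hij : i ≠ j)
    {m : ℕ} (h : ∀ y : Fin s → ℤ_[p], (∀ k, ‖y k - x k‖ ≤ (p : ℝ) ^ (-(m : ℤ))) →
      ∃ z : Fin s → ℤ_[p], IsSolution a b z ∧ ∀ k, k ≠ i → k ≠ j → z k = y k) (n : ℕ) :
    (p ^ n) ^ (s - 2) ≤ solutionCount a b (p ^ (m + n)) := by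
  have hp : p.Prime := Fact.out
  have : NeZero p := ⟨hp.ne_zero⟩
  have hcard : Nat.card ({k : Fin s // k ≠ i ∧ k ≠ j} → Fin (p ^ n)) = (p ^ n) ^ (s - 2) := by
    have h1 : (Finset.univ.filter fun k : Fin s => k ≠ i ∧ k ≠ j) =
        (Finset.univ.erase j).erase i := by
      ext k
      simp
    have h2 : Fintype.card {k : Fin s // k ≠ i ∧ k ≠ j} = s - 2 := by
      rw [Fintype.card_subtype, h1, Finset.card_erase_of_mem (by simp [hij]),
        Finset.card_erase_of_mem (Finset.mem_univ _), Finset.card_univ, Fintype.card_fin]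
      omega
    rw [Nat.card_fun, Nat.card_eq_fintype_card, Nat.card_eq_fintype_card, h2, Fintype.card_fin]
  rw [← hcard]
  set Y : ({k : Fin s // k ≠ i ∧ k ≠ j} → Fin (p ^ n)) → Fin s → ℤ_[p] := fun ζ k =>
    x k + (p : ℤ_[p]) ^ m * ((if hk : k ≠ i ∧ k ≠ j then (ζ ⟨k, hk⟩ : ℕ) else 0 : ℕ) : ℤ_[p])
    with hY
  have hnear : ∀ ζ k, ‖Y ζ k - x k‖ ≤ (p : ℝ) ^ (-(m : ℤ)) := by
    intro ζ k
    simp only [hY, add_sub_cancel_left]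
    rw [norm_mul, PadicInt.norm_p_pow]
    exact mul_le_of_le_one_right (by positivity) (PadicInt.norm_le_one _)
  choose z hz hzk using fun ζ => h (Y ζ) (hnear ζ)
  unfold solutionCount
  refine Nat.card_le_card_of_injective (fun ζ =>
    (⟨_, IsSolution.map (PadicInt.toZModPow (m + n)) (hz ζ)⟩ :
      {x : Fin s → ZMod (p ^ (m + n)) // IsSolution a b x})) ?_
  intro ζ ξ hζξ
  rw [Subtype.mk.injEq] at hζξ
  ext ⟨k, hk⟩
  have h1 := congrFun hζξ k
  simp only [hzk _ k hk.1 hk.2, hY, dif_pos hk, map_add, map_mul, map_pow, map_natCast] at h1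
  have h2 := add_left_cancel h1
  have h3 : ((p ^ m * (ζ ⟨k, hk⟩ : ℕ) : ℕ) : ZMod (p ^ (m + n))) =
      ((p ^ m * (ξ ⟨k, hk⟩ : ℕ) : ℕ) : ZMod (p ^ (m + n))) := by
    push_cast
    exact h2
  rw [ZMod.natCast_eq_natCast_iff, pow_add] at h3
  have h4 := Nat.ModEq.mul_left_cancel' (pow_ne_zero m hp.ne_zero) h3
  exact Nat.ModEq.eq_of_lt_of_lt h4 (ζ ⟨k, hk⟩).2 (ξ ⟨k, hk⟩).2

/-- With p^(n(s-2)) solutions modulo p^(m+n), the normalised count is at least p^(m(2-s)), a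
positive bound independent of n. -/
theorem localDensity_pos (a b : Fin s → ℤ) (hab : ∀ j, (a j, b j) ≠ (0, 0)) (hs : 13 ≤ s)
    (hL : ∀ c d : ℤ, (c, d) ≠ (0, 0) →
      s - 6 ≤ (Finset.univ.filter (fun j : Fin s => c * a j + d * b j ≠ 0)).card)
    (hsum : Summable (weighted a b)) (h : HasNontrivialSolution a b ℚ_[p]) :
    0 < localDensity a b p := by
  have hp : p.Prime := Fact.out
  have hp0 : (0 : ℝ) < p := by exact_mod_cast hp.pos
  obtain ⟨x, hx, i, j, hi, hj, hij⟩ := exists_nonsingular_solution a b hab hs hL h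
  obtain ⟨c, X, hc, hX⟩ := exists_integral_multiple x
  have hXsol : IsSolution a b X := by
    have key : ∀ f : Fin s → ℤ, ∑ k, (f k : ℚ_[p]) * x k ^ 3 = 0 →
        ∑ k, (f k : ℤ_[p]) * X k ^ 3 = 0 := by
      intro f hf
      rw [← PadicInt.coe_eq_zero]
      have : ((∑ k, (f k : ℤ_[p]) * X k ^ 3 : ℤ_[p]) : ℚ_[p]) =
          c ^ 3 * ∑ k, (f k : ℚ_[p]) * x k ^ 3 := by
        rw [Finset.mul_sum, PadicInt.coe_sum]
        refine Finset.sum_congr rfl fun k _ => ?_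
        push_cast
        rw [hX]
        ring
      rw [this, hf, mul_zero]
    exact ⟨key a hx.1, key b hx.2⟩
  have hXne : ∀ k, x k ≠ 0 → X k ≠ 0 := by
    intro k hk h0
    have := hX k
    rw [h0] at this
    exact mul_ne_zero hc hk (by simpa using this.symm)
  have hne : i ≠ j := by
    rintro rfl
    exact hij (by unfold minor; ring)
  obtain ⟨m, hm⟩ := exists_solution_near a b hXsol (hXne i hi) (hXne j hj) hij
  have hlow : ∀ n, (p : ℝ) ^ ((m : ℤ) * (2 - (s : ℤ))) ≤ normalizedCount a b p (n + m) := by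
    intro n
    have h1 := pow_le_solutionCount a b hne hm n
    have h2 : ((p : ℝ) ^ n) ^ (s - 2) ≤ solutionCount a b (p ^ (n + m)) := by
      rw [add_comm n m]
      exact_mod_cast h1
    unfold normalizedCount
    calc (p : ℝ) ^ ((m : ℤ) * (2 - (s : ℤ)))
        = (p : ℝ) ^ (((n + m : ℕ) : ℤ) * (2 - (s : ℤ))) * ((p : ℝ) ^ n) ^ (s - 2) := by
          rw [← zpow_natCast, ← zpow_natCast, ← zpow_mul, ← zpow_add₀ hp0.ne',
            Nat.cast_sub (by omega)]
          congr 1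
          push_cast
          ring
      _ ≤ _ := by gcongr
  have hlim := (tendsto_normalizedCount hsum hp).comp (tendsto_add_atTop_nat m)
  exact lt_of_lt_of_le (by positivity) (ge_of_tendsto' hlim hlow)

end CubicPair

/-! ### The main theorem -/

theorem lemma12 (s : ℕ) (hs : 13 ≤ s) (a b : Fin s → ℤ)
    (hab : ∀ j, (a j, b j) ≠ (0, 0))
    (hL : ∀ c d : ℤ, (c, d) ≠ (0, 0) →
      s - 6 ≤ (Finset.univ.filter (fun j : Fin s => c * a j + d * b j ≠ 0)).card) :
    ∃ (𝔖 : ℝ) (χ : Nat.Primes → ℝ),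
      -- the singular series converges, with the stated tail
      Tendsto (fun X : ℝ => CubicPair.truncatedSingularSeries a b X) atTop (𝓝 (𝔖 : ℂ)) ∧
      (∃ C : ℝ, ∀ X : ℝ, 0 < X →
        ‖(𝔖 : ℂ) - CubicPair.truncatedSingularSeries a b X‖ ≤ C * X ^ (-(1 / 4) : ℝ)) ∧
      -- the limits defining the local densities exist
      (∀ p : Nat.Primes,
        Tendsto (fun h : ℕ => CubicPair.normalizedCount a b (p : ℕ) h) atTop (𝓝 (χ p))) ∧
      -- the Euler product converges absolutely, to the singular series
      Summable (fun p : Nat.Primes => |χ p - 1|) ∧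
      HasProd χ 𝔖 ∧
      -- a local density vanishes exactly when there is a local obstruction
      (∀ p : Nat.Primes, χ p = 0 ↔ ¬ CubicPair.HasNontrivialPadicSolution a b p) ∧
      -- positivity of the singular series
      ((∀ p : Nat.Primes, CubicPair.HasNontrivialPadicSolution a b p) →
        ∃ κ : ℝ, 0 < κ ∧ κ ≤ 𝔖) := by
  have hsum := CubicPair.summable_weighted a b hab hs hL
  have habs := CubicPair.summable_abs_localDensity_sub_one a b hab hs hL
  have hpos : ∀ p : Nat.Primes, CubicPair.HasNontrivialPadicSolution a b p →
      0 < CubicPair.localDensity a b p := fun p hp =>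
    have : Fact (p : ℕ).Prime := ⟨p.2⟩
    CubicPair.localDensity_pos a b hab hs hL hsum hp
  refine ⟨CubicPair.singularSeries a b, fun p => CubicPair.localDensity a b p,
    CubicPair.tendsto_truncatedSingularSeries hsum,
    ⟨_, fun X hX => CubicPair.norm_singularSeries_sub_le hsum hX⟩,
    fun p => CubicPair.tendsto_normalizedCount hsum p.2, habs,
    CubicPair.hasProd_localDensity hsum, fun p => ⟨fun h0 hp => ?_, fun hp => ?_⟩,
    fun hp => ⟨_, CubicPair.singularSeries_pos hsum habs fun p => hpos p (hp p), le_rfl⟩⟩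
  · exact (hpos p hp).ne' h0
  · have : Fact (p : ℕ).Prime := ⟨p.2⟩
    exact CubicPair.localDensity_eq_zero (by omega) hsum p hp
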